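/- **Theorem 1.2.** Let $M$ be a separable finite von Neumann algebra, i.e. a von Neumann algebra acting on a separable complex Hilbert space such that for every nonzero positive $a\in M$ there is a finite normal trace $\tau$ on $M$ with $\tau(a)\neq 0$. Let $G$ be a discrete group and $H\subset G$ a subgroup such that $(G,H)$ has the relative property (T): there are $\delta_0>0$ and a finite subset $F_0\subset G$ such that whenever $\pi:G\to\mathcal U(\mathcal K)$ is a unitary representation with a unit vector $\xi\in\mathcal K$ satisfying $\|\pi(g)\xi-\xi\|<\delta_0$ for all $g\in F_0$, there is a nonzero $\xi_0\in\mathcal K$ with $\pi(h)\xi_0=\xi_0$ for all $h\in H$. If $G$ is uncountable and $H$ is not normal in $G$, the relative property (T) is understood in the following form (equivalent to the above when $G$ is countable or $H$ is normal): for every $\varepsilon>0$ there are a finite $F\subset G$ and $\delta>0$ such that whenever $\pi:G\to\mathcal U(\mathcal K)$ is a unitary representation with a unit vector $\xi$ satisfying $\|\pi(g)\xi-\xi\|<\delta$ for all $g\in F$, there is a unit vector $\xi_0$ with $\|\xi_0-\xi\|<\varepsilon$ and $\pi(h)\xi_0=\xi_0$ for all $h\in H$. For a group $K$, let $Z^2(K,\mathbb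 T)$ be the multiplicative group of scalar 2-cocycles, i.e. maps $\mu:K\times K\to\mathbb T$ with $\mu_{g,h}\mu_{gh,k}=\mu_{h,k}\mu_{g,hk}$ for all $g,h,k\in K$; let $B^2(K,\mathbb T)$ be its subgroup of coboundaries $\mu_{g,h}=\lambda_g\lambda_h\overline{\lambda_{gh}}$ with $\lambda:K\to\mathbb T$; and let $H^2(K,\mathbb T)=Z^2(K,\mathbb T)/B^2(K,\mathbb T)$. Let $(p_j)_{j\in J}$ be a family (with an arbitrary index set $J$) of nonzero projections in $M$. For each $j\in J$ let $\pi_j$ be a projective representation of $G$ into the unitary group of $p_jMp_j$ with scalar 2-cocycle $\mu_j\in Z^2(G,\mathbb T)$, i.e. a map $\pi_j:G\to\mathcal U(p_jMp_j)$ with $\pi_j(g)\pi_j(h)=(\mu_j)_{g,h}\,\pi_j(gh)$ for all $g,h\in G$. Then the image of the set $\{\mu_j|_H\}_{j\in J}$ in $H^2(H,\mathbb T)$ is at most countable. -/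

import Mathlib

open scoped ComplexOrder

universe u v w

/-- The group `Z²(G, 𝕋)` of scalar 2-cocycles of `G`: maps `μ : G × G → 𝕋` with
`μ_{g,h} μ_{gh,k} = μ_{h,k} μ_{g,hk}`, under pointwise multiplication. -/
def scalarTwoCocycles (G : Type u) [Group G] : Subgroup (G → G → Circle) where
  carrier := {μ | ∀ g h k : G, μ g h * μ (g * h) k = μ h k * μ g (h * k)}
  one_mem' := fun g h k => by simp
  mul_mem' := by
    intro a b ha hb g h k
    simp only [Pi.mul_apply]
    rw [mul_mul_mul_comm, ha g h k, hb g h k, mul_mul_mul_comm]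
  inv_mem' := by
    intro a ha g h k
    simp only [Pi.inv_apply]
    rw [← mul_inv, ← mul_inv, ha g h k]

/-- The group `B²(G, 𝕋)` of scalar 2-coboundaries of `G`: maps of the form
`(g, h) ↦ l_g l_h (l_{gh})⁻¹` with `l : G → 𝕋`. -/
def scalarTwoCoboundaries (G : Type u) [Group G] : Subgroup (G → G → Circle) where
  carrier := {μ | ∃ l : G → Circle, ∀ g h : G, μ g h = l g * l h * (l (g * h))⁻¹}
  one_mem' := ⟨1, fun g h => by simp⟩
  mul_mem' := by
    rintro a b ⟨l, hl⟩ ⟨m, hm⟩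
    refine ⟨l * m, fun g h => ?_⟩
    simp only [Pi.mul_apply, hl, hm, mul_inv]
    rw [mul_mul_mul_comm, mul_mul_mul_comm (l g)]
  inv_mem' := by
    rintro a ⟨l, hl⟩
    refine ⟨l⁻¹, fun g h => ?_⟩
    simp only [Pi.inv_apply, hl, mul_inv]

/-- Every 2-coboundary is a 2-cocycle. -/
theorem scalarTwoCoboundaries_le_scalarTwoCocycles (G : Type u) [Group G] :
    scalarTwoCoboundaries G ≤ scalarTwoCocycles G := by
  rintro a ⟨l, hl⟩ g h k
  rw [hl, hl, hl, hl, mul_assoc g h k]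
  have e : l g * l h * (l (g * h))⁻¹ * (l (g * h) * l k * (l (g * (h * k)))⁻¹)
      = l g * l h * l k * (l (g * (h * k)))⁻¹ * ((l (g * h))⁻¹ * l (g * h)) := by
    simp only [mul_comm, mul_left_comm, mul_assoc]
  have e' : l h * l k * (l (h * k))⁻¹ * (l g * l (h * k) * (l (g * (h * k)))⁻¹)
      = l g * l h * l k * (l (g * (h * k)))⁻¹ * ((l (h * k))⁻¹ * l (h * k)) := by
    simp only [mul_comm, mul_left_comm, mul_assoc]
  rw [e, e', inv_mul_cancel, inv_mul_cancel]

/-- The second cohomology group `H²(G, 𝕋) = Z²(G, 𝕋) / B²(G, 𝕋)` (trivial action on `𝕋`). -/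
abbrev ScalarH2 (G : Type u) [Group G] : Type u :=
  scalarTwoCocycles G ⧸ (scalarTwoCoboundaries G).subgroupOf (scalarTwoCocycles G)

/-- The restriction `μ|_H` of a scalar 2-cocycle of `G` to a subgroup `H`. -/
def restrictTwoCocycle {G : Type u} [Group G] (H : Subgroup G) (μ : scalarTwoCocycles G) :
    scalarTwoCocycles H :=
  ⟨fun h k => (μ : G → G → Circle) h k, fun g h k => μ.2 (g : G) (h : G) (k : G)⟩

/-- The relative property (T) of Kazhdan-Margulis for a subgroup `H` of a discrete group `G`.
It is enough to let the Hilbert space run over the universe of `G`: the cyclic representation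
generated by a vector is realized on a space of functions on `G`. -/
def HasRelativePropertyT {G : Type u} [Group G] (H : Subgroup G) : Prop :=
  ∃ δ : ℝ, 0 < δ ∧ ∃ F : Finset G,
    ∀ (V : Type u) [NormedAddCommGroup V] [InnerProductSpace ℂ V] [CompleteSpace V]
      (π : G →* unitary (V →L[ℂ] V)) (ξ : V), ‖ξ‖ = 1 →
      (∀ g ∈ F, ‖(π g : V →L[ℂ] V) ξ - ξ‖ < δ) →
      ∃ ξ₀ : V, ξ₀ ≠ 0 ∧ ∀ h ∈ H, (π h : V →L[ℂ] V) ξ₀ = ξ₀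

/-- The form of the relative property (T) with control on the distance: almost invariant
unit vectors are close to `H`-invariant unit vectors. It implies `HasRelativePropertyT`, and is
equivalent to it when `G` is countable or `H` is normal in `G`. -/
def HasUniformRelativePropertyT {G : Type u} [Group G] (H : Subgroup G) : Prop :=
  ∀ ε : ℝ, 0 < ε → ∃ F : Finset G, ∃ δ : ℝ, 0 < δ ∧
    ∀ (V : Type u) [NormedAddCommGroup V] [InnerProductSpace ℂ V] [CompleteSpace V]
      (π : G →* unitary (V →L[ℂ] V)) (ξ : V), ‖ξ‖ = 1 →
      (∀ g ∈ F, ‖(π g : V →L[ℂ] V) ξ - ξ‖ < δ) →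
      ∃ ξ₀ : V, ‖ξ₀‖ = 1 ∧ ‖ξ₀ - ξ‖ < ε ∧ ∀ h ∈ H, (π h : V →L[ℂ] V) ξ₀ = ξ₀

section VonNeumann

variable {𝓗 : Type v} [NormedAddCommGroup 𝓗] [InnerProductSpace ℂ 𝓗] [CompleteSpace 𝓗]

/-- A (finite) normal trace on `M`: a positive linear functional `τ` on `M` with
`τ(xy) = τ(yx)` which is ultraweakly continuous, that is, of the form
`τ(x) = ∑ ⟨ξ_n, x η_n⟩` with `∑ ‖ξ_n‖² < ∞` and `∑ ‖η_n‖² < ∞`. -/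
structure IsNormalTrace (M : VonNeumannAlgebra 𝓗) (τ : M.toStarSubalgebra →ₗ[ℂ] ℂ) : Prop where
  nonneg : ∀ x : M.toStarSubalgebra, 0 ≤ τ (star x * x)
  trace : ∀ x y : M.toStarSubalgebra, τ (x * y) = τ (y * x)
  normal : ∃ ξ η : ℕ → 𝓗, Summable (fun n => ‖ξ n‖ ^ 2) ∧ Summable (fun n => ‖η n‖ ^ 2) ∧
    ∀ x : M.toStarSubalgebra,
      HasSum (fun n => inner ℂ (ξ n) ((x : 𝓗 →L[ℂ] 𝓗) (η n))) (τ x)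

/-- `M` is a finite von Neumann algebra (Dixmier's definition): for every nonzero positive
element `x* x` of `M` there is a finite normal trace `τ` on `M` with `τ(x* x) ≠ 0`. -/
def IsFiniteVonNeumann (M : VonNeumannAlgebra 𝓗) : Prop :=
  ∀ x : M.toStarSubalgebra, x ≠ 0 →
    ∃ τ : M.toStarSubalgebra →ₗ[ℂ] ℂ, IsNormalTrace M τ ∧ τ (star x * x) ≠ 0

/-- `u` belongs to the unitary group of the corner `p M p`, whose unit is `p`. -/
structure IsCornerUnitary (M : VonNeumannAlgebra 𝓗) (p u : 𝓗 →L[ℂ] 𝓗) : Prop where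
  mem : u ∈ M
  corner : p * u * p = u
  star_mul_self : star u * u = p
  mul_star_self : u * star u = p

/-- `π` is a projective representation of `G` into the unitary group of `p M p`, with scalar
2-cocycle `μ`: `π(g) π(h) = μ_{g,h} π(gh)`. -/
structure IsProjectiveRep {G : Type u} [Group G] (M : VonNeumannAlgebra 𝓗) (p : 𝓗 →L[ℂ] 𝓗)
    (μ : scalarTwoCocycles G) (π : G → 𝓗 →L[ℂ] 𝓗) : Prop where
  unitary : ∀ g : G, IsCornerUnitary M p (π g)
  mul : ∀ g h : G, π g * π h = (((μ : G → G → Circle) g h : Circle) : ℂ) • π (g * h)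

end VonNeumann

/-!
Write `c = μ_i / μ_j`. Then `c|_H` is a coboundary as soon as `π_i` and `π_j` are close on a
suitable finite subset `F` of `G`, and separability leaves only countably many `j` up to closeness.

*Separability.* For each `j` there is a normal trace `τ_j` with `τ_j(p_j) = 1`, given by two
square-summable sequences `ξ_j`, `η_j` of vectors. Up to a small error only finitely many terms
matter, so `j` is described by two natural numbers (the number of terms and a bound on the `ξ_j`)
and by the finitely many vectors `η_j(n)`, `π_j(g)* η_j(n)`, `g ∈ F`, in a separable space. If these
data are close for `i` and `j`, then `τ_i(π_i(g) π_j(g)*)` is close to `τ_i(p_i) = 1` on `F`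
(`norm_le_of_hasSum_inner`, `countable_image_of_dist_lt`). No trace that works for all `j`
simultaneously is needed.

*Property (T).* Put `v_g = π_i(g) π_j(g)*` and `τ = τ_i`. The kernel `k(x, y) = τ(v_x* v_y)` is
positive semidefinite and satisfies `k(gx, gy) = c(g, x) conj(c(g, y)) k(x, y)`, whence `|k|²` is a
`G`-invariant kernel and `φ(g) = |τ(v_g)|² / |τ(v_1)|²` is a positive definite function on `G`,
close to `1` on `F`. The relative property (T) makes it close to `1` on all of `H`
(`IsCornerRep.mem_coboundaries`). So in the Hilbert space of `k`, the orbit of a line under the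
projective representation of `H` with cocycle `c|_H` consists of pairwise close lines. Such a family
of lines has a canonical circumcentre (`exists_circumcentre`), which is thus an `H`-invariant line,
and a projective representation with an invariant line has a trivial cocycle
(`mem_scalarTwoCoboundaries_of_kernel`).

*Uniformity.* This uses the relative property (T) in the form `HasPositiveDefinitePropertyT`, with
control on all of `H`. For normal `H` the orthogonal complement of the `H`-invariant vectors is a
representation of `G` without `H`-invariant vectors, hence without almost invariant ones. For
countable `G`, if the uniform form fails along positive definite functions `φ_n` that converge to
`1` quickly, then `ψ = ∑ 2ⁿ (1 - Re φ_n)` is finite but unbounded on `H`, and for small `t` the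
representation given by `exp(-tψ)` has almost invariant vectors, while a sequence in `H` tends
weakly to `0` in it, which excludes nonzero `H`-invariant vectors.
-/

open Filter Topology

/-! ### Positive semidefinite kernels -/

/-- A positive semidefinite kernel is the Gram matrix of a total family of vectors in a Hilbert
space, which can be found in the universe of the index set. -/
theorem exists_gram_of_posSemidef {X : Type u} {K : Matrix X X ℂ} (hK : K.PosSemidef) :
    ∃ (V : Type u) (_ : NormedAddCommGroup V) (_ : InnerProductSpace ℂ V) (_ : CompleteSpace V)
      (v : X → V), (∀ x y, inner ℂ (v x) (v y) = K x y) ∧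
        Dense (Submodule.span ℂ (Set.range v) : Set V) := by
  let L : Matrix X X (ℂ →L[ℂ] ℂ) := Matrix.of fun x y => K x y • 1
  have hL : L.PosSemidef := by
    have hherm : L.IsHermitian := by
      ext x y
      simp [L, Matrix.conjTranspose_apply, star_smul, ← hK.1.apply x y]
    have htfae := (RKHS.posSemidef_tfae (K := L)).out 0 2
    refine htfae.mpr (And.intro hherm fun f => ?_)
    have := (Complex.nonneg_iff.mp (hK.2 f)).1
    refine this.trans_eq (congrArg Complex.re ?_)
    refine Finsupp.sum_congr fun x _ => Finsupp.sum_congr fun y _ => ?_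
    simp [L, ← hK.1.apply x y]
    ring
  have : Fact L.PosSemidef := ⟨hL⟩
  refine ⟨RKHS.OfKernel L, inferInstance, inferInstance, inferInstance,
    fun x => RKHS.kerFun (RKHS.OfKernel L) x 1, fun x y => ?_, ?_⟩
  · have := RKHS.kernel_inner (RKHS.OfKernel L) y x (1:ℂ) (1:ℂ)
    rw [← this, RKHS.OfKernel.kernel_ofKernel]
    simp [L, ← hK.1.apply x y]
  · have := RKHS.kerFun_dense (RKHS.OfKernel L)
    rw [← Submodule.dense_iff_topologicalClosure_eq_top] at this
    refine this.mono ?_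
    refine Submodule.span_le.mpr ?_
    rintro _ ⟨x, z, rfl⟩
    have : RKHS.kerFun (RKHS.OfKernel L) x z = z • RKHS.kerFun (RKHS.OfKernel L) x 1 := by
      rw [← map_smul]; simp
    rw [this]
    exact Submodule.smul_mem _ _ (Submodule.subset_span ⟨x, rfl⟩)

/-- Families with the same Gram matrix differ by an isometry if the first one is total. -/
theorem exists_linearIsometry_of_inner_eq {X V W : Type*} [NormedAddCommGroup V]
    [InnerProductSpace ℂ V] [NormedAddCommGroup W] [InnerProductSpace ℂ W] [CompleteSpace W]
    {v : X → V} {w : X → W} (hv : Dense (Submodule.span ℂ (Set.range v) : Set V))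
    (hvw : ∀ x y, inner ℂ (v x) (v y) = inner ℂ (w x) (w y)) :
    ∃ T : V →ₗᵢ[ℂ] W, ∀ x, T (v x) = w x := by
  set e := Finsupp.linearCombination ℂ v
  set f := Finsupp.linearCombination ℂ w
  have he : DenseRange e := by
    rw [DenseRange, ← LinearMap.coe_range, Finsupp.range_linearCombination]
    exact hv
  have hfe : ∀ a, ‖f a‖ = ‖e a‖ := by
    intro a
    rw [← sq_eq_sq₀ (norm_nonneg _) (norm_nonneg _), ← inner_self_eq_norm_sq (𝕜 := ℂ),
      ← inner_self_eq_norm_sq (𝕜 := ℂ)]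
    simp only [e, f, Finsupp.linearCombination_apply, Finsupp.sum_inner, Finsupp.inner_sum, hvw,
      inner_smul_left, inner_smul_right]
  have hn : ∃ C, ∀ x, ‖f x‖ ≤ C * ‖e x‖ := ⟨1, fun x => by rw [hfe, one_mul]⟩
  refine ⟨⟨f.extendOfNorm e, fun x => ?_⟩, fun x => ?_⟩
  · refine he.induction_on (p := fun x => ‖f.extendOfNorm e x‖ = ‖x‖) x ?_ ?_
    · exact isClosed_eq (by fun_prop) (by fun_prop)
    · intro a
      rw [LinearMap.extendOfNorm_eq he hn, hfe]
  · have := LinearMap.extendOfNorm_eq he hn (Finsupp.single x 1)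
    simpa [e, f] using this

theorem posSemidef_of_tendsto {X ι : Type*} {l : Filter ι} [l.NeBot] {K : ι → Matrix X X ℂ}
    {L : Matrix X X ℂ} (hK : ∀ i, (K i).PosSemidef)
    (hL : ∀ x y, Tendsto (fun i => K i x y) l (𝓝 (L x y))) : L.PosSemidef := by
  refine ⟨?_, fun f => ?_⟩
  · ext x y
    rw [Matrix.conjTranspose_apply]
    refine tendsto_nhds_unique ((hL y x).star) ?_
    simpa only [(hK _).1.apply] using hL x y
  · have : Tendsto (fun i => f.sum fun x a => f.sum fun y b => star a * K i x y * b) l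
        (𝓝 (f.sum fun x a => f.sum fun y b => star a * L x y * b)) := by
      refine tendsto_finsetSum _ fun x _ => tendsto_finsetSum _ fun y _ => ?_
      exact ((hL x y).const_mul _).mul_const _
    exact ge_of_tendsto' this fun i => (hK i).2 f

theorem posSemidef_of_inner {X V : Type*} [SeminormedAddCommGroup V] [InnerProductSpace ℂ V]
    (v : X → V) : (Matrix.of fun x y => inner ℂ (v x) (v y)).PosSemidef := by
  refine ⟨?_, fun f => ?_⟩
  · ext x y
    simp
  · have : (f.sum fun x a => f.sum fun y b => star a * inner ℂ (v x) (v y) * b)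
        = inner ℂ (f.sum fun x a => a • v x) (f.sum fun x a => a • v x) := by
      rw [Finsupp.sum_inner]
      refine Finsupp.sum_congr fun x _ => ?_
      rw [Finsupp.inner_sum]
      refine Finsupp.sum_congr fun y _ => ?_
      simp [inner_smul_left, inner_smul_right, mul_left_comm, mul_comm]
    simp only [Matrix.of_apply]
    rw [this, inner_self_eq_norm_sq_to_K]
    positivity

theorem posSemidef_const {X : Type*} {c : ℂ} (hc : 0 ≤ c) :
    (Matrix.of fun _ _ : X => c).PosSemidef := by
  have := (posSemidef_of_inner (fun _ : X => (1 : ℂ))).smul hc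
  convert this using 1
  ext; simp

theorem posSemidef_pow {X : Type*} {K : Matrix X X ℂ} (hK : K.PosSemidef) (n : ℕ) :
    (Matrix.of fun x y => K x y ^ n).PosSemidef := by
  induction n with
  | zero => simpa using posSemidef_const (X := X) zero_le_one
  | succ n ih => 
    simp only [pow_succ]
    exact ih.hadamard hK

/-- Schur's product theorem for finitely many kernels. -/
theorem posSemidef_prod {X ι : Type*} (s : Finset ι) {K : ι → Matrix X X ℂ}
    (hK : ∀ i, (K i).PosSemidef) : (Matrix.of fun x y => ∏ i ∈ s, K i x y).PosSemidef := by
  classical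
  induction s using Finset.induction_on with
  | empty => simpa using posSemidef_const (X := X) zero_le_one
  | insert i s hi ih => 
    simp only [Finset.prod_insert hi]
    exact (hK i).hadamard ih

theorem posSemidef_exp {X : Type*} {K : Matrix X X ℂ} (hK : K.PosSemidef) :
    (Matrix.of fun x y => Complex.exp (K x y)).PosSemidef := by
  refine posSemidef_of_tendsto (l := atTop)
    (K := fun N : ℕ => Matrix.of fun x y => ∑ n ∈ Finset.range N, K x y ^ n / n.factorial)
    (fun N => ?_) fun x y => ?_
  · have := Matrix.posSemidef_sum (Finset.range N) (x := fun n =>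
      (n.factorial : ℂ)⁻¹ • (Matrix.of fun x y => K x y ^ n)) fun n _ =>
        (posSemidef_pow hK n).smul (by positivity)
    convert this using 1
    ext x y
    simp [Matrix.sum_apply, div_eq_inv_mul]
  · rw [Complex.exp_eq_exp_ℂ]
    exact (NormedSpace.expSeries_div_hasSum_exp (K x y)).tendsto_sum_nat

/-! ### Positive definite functions on groups -/

/-- A function `φ : G → ℂ` is positive definite if the kernel `(x, y) ↦ φ (x⁻¹ y)` is positive
semidefinite. -/
def IsPositiveDefinite {G : Type u} [Group G] (φ : G → ℂ) : Prop :=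
  (Matrix.of fun x y : G => φ (x⁻¹ * y)).PosSemidef

/-- A homomorphism from a group into the isometric operators takes unitary values. -/
theorem MonoidHom.exists_unitary_of_norm_map {G V : Type*} [Group G] [NormedAddCommGroup V]
    [InnerProductSpace ℂ V] [CompleteSpace V] (S : G →* (V →L[ℂ] V))
    (hS : ∀ g x, ‖S g x‖ = ‖x‖) :
    ∃ π : G →* unitary (V →L[ℂ] V), ∀ g, (π g : V →L[ℂ] V) = S g := by
  have hstar : ∀ g, star (S g) * S g = 1 := fun g =>
    (ContinuousLinearMap.norm_map_iff_adjoint_comp_self _).mp (hS g)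
  have hstar' : ∀ g, S g * star (S g) = 1 := fun g => by
    have h1 : S g * S g⁻¹ = 1 := by rw [← map_mul, mul_inv_cancel, map_one]
    calc S g * star (S g) = S g * star (S g) * (S g * S g⁻¹) := by rw [h1, mul_one]
      _ = S g * (star (S g) * S g) * S g⁻¹ := by simp only [mul_assoc]
      _ = 1 := by rw [hstar, mul_one, h1]
  exact ⟨⟨⟨fun g => ⟨S g, hstar g, hstar' g⟩, Subtype.ext (map_one S)⟩, fun g h =>
    Subtype.ext (map_mul S g h)⟩, fun _ => rfl⟩

/-- A family of vectors indexed by a group, with left invariant Gram matrix, is translated by a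
unitary representation. -/
theorem exists_monoidHom_unitary {G V : Type*} [Group G] [NormedAddCommGroup V]
    [InnerProductSpace ℂ V] [CompleteSpace V] {v : G → V}
    (hv : Dense (Submodule.span ℂ (Set.range v) : Set V))
    (hinv : ∀ g x y, inner ℂ (v (g * x)) (v (g * y)) = inner ℂ (v x) (v y)) :
    ∃ π : G →* unitary (V →L[ℂ] V), ∀ g x, (π g : V →L[ℂ] V) (v x) = v (g * x) := by
  choose T hT using fun g => exists_linearIsometry_of_inner_eq (w := fun x => v (g * x)) hv
    fun x y => (hinv g x y).symm
  have hext : ∀ A B : V →L[ℂ] V, (∀ x, A (v x) = B (v x)) → A = B := fun A B h =>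
    ContinuousLinearMap.ext_on hv (by rintro _ ⟨x, rfl⟩; exact h x)
  let S : G → V →L[ℂ] V := fun g => (T g).toContinuousLinearMap
  have hS : ∀ g x, S g (v x) = v (g * x) := hT
  obtain ⟨π, hπ⟩ := MonoidHom.exists_unitary_of_norm_map
    ⟨⟨S, hext _ _ fun x => by simp [hS]⟩, fun g h => hext _ _ fun x => by simp [hS, mul_assoc]⟩
    fun g => (T g).norm_map
  exact ⟨π, fun g x => by rw [hπ]; exact hS g x⟩

/-- The GNS construction: `φ(x⁻¹ y) = ⟨v_x, v_y⟩` for the orbit `v_x = π(x) v_1` of a cyclic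
vector. -/
theorem IsPositiveDefinite.exists_rep {G : Type u} [Group G] {φ : G → ℂ}
    (hφ : IsPositiveDefinite φ) :
    ∃ (V : Type u) (_ : NormedAddCommGroup V) (_ : InnerProductSpace ℂ V) (_ : CompleteSpace V)
      (π : G →* unitary (V →L[ℂ] V)) (v : G → V), (∀ x y, inner ℂ (v x) (v y) = φ (x⁻¹ * y)) ∧
        (∀ g x, (π g : V →L[ℂ] V) (v x) = v (g * x)) ∧
        Dense (Submodule.span ℂ (Set.range v) : Set V) := by
  obtain ⟨V, _, _, _, v, hv, hd⟩ := exists_gram_of_posSemidef hφ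
  obtain ⟨π, hπ⟩ := exists_monoidHom_unitary hd (fun g x y => by simp [hv, mul_assoc])
  exact ⟨V, _, _, _, π, v, hv, hπ, hd⟩

theorem norm_sub_sq_eq_of_norm_eq_one {V : Type*} [NormedAddCommGroup V] [InnerProductSpace ℂ V]
    {x y : V} (hx : ‖x‖ = 1) (hy : ‖y‖ = 1) : ‖x - y‖ ^ 2 = 2 - 2 * (inner ℂ x y).re := by
  have := @norm_sub_sq ℂ V _ _ _ x y
  rw [this, hx, hy]
  simp only [RCLike.re_eq_complex_re]
  ring

section GNS

variable {G V : Type*} [Group G] [NormedAddCommGroup V] [InnerProductSpace ℂ V] {φ : G → ℂ}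
  {v : G → V}

theorem norm_eq_one_of_gram (hv : ∀ x y, inner ℂ (v x) (v y) = φ (x⁻¹ * y)) (h1 : φ 1 = 1)
    (x : G) : ‖v x‖ = 1 := by
  have := inner_self_eq_norm_sq_to_K (𝕜 := ℂ) (v x)
  rw [hv, inv_mul_cancel, h1] at this
  have h2 : ‖v x‖ ^ 2 = 1 := Complex.ofReal_injective (by push_cast; exact this.symm)
  exact (pow_eq_one_iff_of_nonneg (norm_nonneg _) two_ne_zero).mp h2

theorem norm_sub_sq_of_gram (hv : ∀ x y, inner ℂ (v x) (v y) = φ (x⁻¹ * y)) (h1 : φ 1 = 1)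
    (x y : G) : ‖v x - v y‖ ^ 2 = 2 - 2 * (φ (x⁻¹ * y)).re := by
  rw [norm_sub_sq_eq_of_norm_eq_one (norm_eq_one_of_gram hv h1 x) (norm_eq_one_of_gram hv h1 y),
    hv]

/-- A function `φ` with `φ(x⁻¹ y) = ⟨v_x, v_y⟩` is close to `1` where the orbit of `v_1` is close to
`v_1`. The converse is `norm_sub_sq_le_of_gram`. -/
theorem norm_sub_one_le_of_gram (hv : ∀ x y, inner ℂ (v x) (v y) = φ (x⁻¹ * y)) (h1 : φ 1 = 1)
    (x : G) : ‖φ x - 1‖ ≤ ‖v x - v 1‖ := by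
  have : φ x - 1 = inner ℂ (v 1) (v x - v 1) := by
    rw [inner_sub_right, hv, hv]; simp [h1]
  rw [this]
  refine (norm_inner_le_norm _ _).trans ?_
  rw [norm_eq_one_of_gram hv h1, one_mul]

theorem norm_sub_sq_le_of_gram (hv : ∀ x y, inner ℂ (v x) (v y) = φ (x⁻¹ * y)) (h1 : φ 1 = 1)
    (x : G) : ‖v x - v 1‖ ^ 2 ≤ 2 * ‖φ x - 1‖ := by
  rw [norm_sub_rev, norm_sub_sq_of_gram hv h1]
  have := Complex.abs_re_le_norm (φ x - 1)
  have h2 := neg_abs_le (φ x - 1).re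
  simp at this h2 ⊢
  linarith

end GNS

/-! ### Relative property (T) and positive definite functions -/

/-- The relative property (T) in terms of positive definite functions: on `H`, convergence to `1`
of normalized positive definite functions on `G` is uniform. -/
def HasPositiveDefinitePropertyT {G : Type u} [Group G] (H : Subgroup G) : Prop :=
  ∀ ε : ℝ, 0 < ε → ∃ F : Finset G, ∃ δ : ℝ, 0 < δ ∧ ∀ φ : G → ℂ, IsPositiveDefinite φ → φ 1 = 1 →
    (∀ g ∈ F, ‖φ g - 1‖ < δ) → ∀ h ∈ H, ‖φ h - 1‖ ≤ ε

theorem norm_unitary_apply {V : Type*} [NormedAddCommGroup V] [InnerProductSpace ℂ V]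
    [CompleteSpace V] (U : unitary (V →L[ℂ] V)) (x : V) : ‖(U : V →L[ℂ] V) x‖ = ‖x‖ :=
  (ContinuousLinearMap.norm_map_iff_adjoint_comp_self _).mpr U.2.1 x

theorem HasUniformRelativePropertyT.positiveDefinite {G : Type u} [Group G] {H : Subgroup G}
    (hU : HasUniformRelativePropertyT H) : HasPositiveDefinitePropertyT H := by
  intro ε hε
  obtain ⟨F, δ, hδ, h⟩ := hU (ε / 2) (by positivity)
  refine ⟨F, δ ^ 2 / 2, by positivity, fun φ hφ h1 hF g hg => ?_⟩
  obtain ⟨V, _, _, _, π, v, hv, hπ, -⟩ := hφ.exists_rep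
  obtain ⟨ξ, -, hξ, hinv⟩ := h V π (v 1) (norm_eq_one_of_gram hv h1 1) fun g hg => by
    rw [hπ, mul_one]
    refine lt_of_pow_lt_pow_left₀ 2 hδ.le ?_
    linarith [norm_sub_sq_le_of_gram hv h1 g, hF g hg]
  refine (norm_sub_one_le_of_gram hv h1 g).trans ?_
  have e : v g - v 1 = (ξ - v 1) - (π g : V →L[ℂ] V) (ξ - v 1) := by
    rw [map_sub, hinv g hg, hπ, mul_one]; abel
  rw [e]
  refine (norm_sub_le _ _).trans ?_
  rw [norm_unitary_apply]
  linarith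

/-- For normal `H` the complement of the `H`-invariant vectors is `G`-invariant and has no almost
invariant unit vectors, so almost invariant vectors are close to their `H`-invariant part. -/
theorem HasRelativePropertyT.positiveDefinite_of_normal {G : Type u} [Group G] {H : Subgroup G}
    (hT : HasRelativePropertyT H) (hH : H.Normal) : HasPositiveDefinitePropertyT H := by
  intro ε hε
  obtain ⟨δ, hδ, F, h⟩ := hT
  refine ⟨F, (δ * ε / 4) ^ 2 / 2, by positivity, fun φ hφ h1 hF g hg => ?_⟩
  obtain ⟨V, _, _, _, π, v, hv, hπ, -⟩ := hφ.exists_rep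
  -- `W` is the space of `H`-invariant vectors; by normality of `H` it is `G`-invariant.
  let W : Submodule ℂ V := ⨅ k : H, LinearMap.ker ((π k : V →L[ℂ] V) - 1 : V →L[ℂ] V).toLinearMap
  have hW : ∀ x, x ∈ W ↔ ∀ k ∈ H, (π k : V →L[ℂ] V) x = x := fun x => by
    simp [W, Submodule.mem_iInf, sub_eq_zero]
  have hWc : IsClosed (W : Set V) := by
    have : (W : Set V) = ⋂ k : H, {x | (π k : V →L[ℂ] V) x = x} := by
      ext x; simp [hW]
    rw [this]
    exact isClosed_iInter fun k => isClosed_eq (by fun_prop) (by fun_prop)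
  have : CompleteSpace W := hWc.completeSpace_coe
  have hmul : ∀ (a b : G) (x : V),
      (π (a * b) : V →L[ℂ] V) x = (π a : V →L[ℂ] V) ((π b : V →L[ℂ] V) x) :=
    fun a b x => by rw [map_mul]; rfl
  have hWG : ∀ (a : G) (x : V), x ∈ W → (π a : V →L[ℂ] V) x ∈ W := fun a x hx => by
    rw [hW] at hx ⊢
    intro k hk
    have : k * a = a * (a⁻¹ * k * a) := by group
    rw [← hmul, this, hmul, hx]
    simpa using hH.conj_mem k hk a⁻¹
  have hinner : ∀ (a : G) (x y : V),
      inner ℂ ((π a : V →L[ℂ] V) x) ((π a : V →L[ℂ] V) y) = inner ℂ x y := fun a x y =>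
    ContinuousLinearMap.inner_map_map_of_mem_unitary (π a).2 x y
  have hWperp : ∀ (a : G) (x : V), x ∈ Wᗮ → (π a : V →L[ℂ] V) x ∈ Wᗮ := fun a x hx => by
    rw [Submodule.mem_orthogonal] at hx ⊢
    intro w hw
    have := hx _ (hWG a⁻¹ w hw)
    rw [← hinner a, ← hmul] at this
    simpa using this
  let S : G →* (Wᗮ →L[ℂ] Wᗮ) :=
    { toFun := fun a => ((π a : V →L[ℂ] V) ∘L Wᗮ.subtypeL).codRestrict Wᗮ
        fun x => hWperp a x x.2
      map_one' := by ext x; simp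
      map_mul' := fun a b => by ext x; exact hmul a b x }
  have hSapply : ∀ (a : G) (x : Wᗮ), ((S a x : Wᗮ) : V) = (π a : V →L[ℂ] V) x := fun _ _ => rfl
  obtain ⟨ρ, hρ⟩ := MonoidHom.exists_unitary_of_norm_map S fun a x => by
    rw [Submodule.coe_norm, hSapply, norm_unitary_apply, Submodule.coe_norm]
  -- `Wᗮ` has no nonzero `H`-invariant vector, so it has no `(F, δ)`-invariant unit vector.
  have key : ∀ x : Wᗮ, (∀ a ∈ F, ‖(π a : V →L[ℂ] V) x - x‖ < δ * ‖x‖) → x = 0 := by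
    intro x hx
    by_contra hx0
    have hn : 0 < ‖x‖ := norm_pos_iff.mpr hx0
    obtain ⟨ξ, hξ0, hξ⟩ := h Wᗮ ρ (((‖x‖⁻¹ : ℝ) : ℂ) • x)
      (by rw [norm_smul, Complex.norm_real, norm_inv, norm_norm, inv_mul_cancel₀ hn.ne'])
      fun a ha => by
        rw [map_smul, ← smul_sub, norm_smul, Complex.norm_real, norm_inv, norm_norm, hρ,
          Submodule.coe_norm (S a x - x), Submodule.coe_sub, hSapply, inv_mul_lt_iff₀ hn, mul_comm]
        exact hx a ha
    have hmem : (ξ : V) ∈ W := (hW _).mpr fun k hk => by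
      rw [← hSapply, ← hρ, hξ k hk]
    exact hξ0 (Subtype.ext (inner_self_eq_zero.mp (ξ.2 _ hmem)))
  have hdecomp : ∃ y ∈ W, ∃ x : Wᗮ, v 1 = y + x := by
    obtain ⟨y, hy, z, hz, hyz⟩ := W.exists_add_mem_mem_orthogonal (v 1)
    exact ⟨y, hy, ⟨z, hz⟩, hyz⟩
  obtain ⟨y, hy, x, hyx⟩ := hdecomp
  have hx_le : ‖x‖ ≤ ε / 2 := by
    by_contra! hlt
    have hn : 0 < ‖x‖ := lt_trans (by positivity) hlt
    refine hn.ne' (norm_eq_zero.mpr (key x fun a ha => ?_))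
    have h2 : ‖v a - v 1‖ < δ * ‖x‖ := by
      refine lt_of_pow_lt_pow_left₀ 2 (by positivity) ?_
      have h3 : (δ * ε / 4) ^ 2 < (δ * ‖x‖) ^ 2 := by
        gcongr
        have := mul_lt_mul_of_pos_left hlt hδ
        nlinarith [mul_pos hδ hε]
      linarith [norm_sub_sq_le_of_gram hv h1 a, hF a ha]
    -- the component of `π(a) v_1 - v_1` in `Wᗮ` is `π(a) x - x`
    refine lt_of_le_of_lt (le_of_sq_le_sq ?_ (norm_nonneg _)) h2
    have h4 : v a - v 1 = ((π a : V →L[ℂ] V) y - y) + ((π a : V →L[ℂ] V) x - x) := by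
      have : v a = (π a : V →L[ℂ] V) (v 1) := by rw [hπ, mul_one]
      rw [this, hyx, map_add]; abel
    have h5 : inner ℂ ((π a : V →L[ℂ] V) y - y) ((π a : V →L[ℂ] V) x - x) = 0 :=
      Submodule.inner_right_of_mem_orthogonal (W.sub_mem (hWG a y hy) hy)
        (Wᗮ.sub_mem (hWperp a x x.2) x.2)
    rw [h4, sq, sq, norm_add_sq_eq_norm_sq_add_norm_sq_of_inner_eq_zero _ _ h5]
    nlinarith [norm_nonneg ((π a : V →L[ℂ] V) y - y)]
  refine (norm_sub_one_le_of_gram hv h1 g).trans ?_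
  have e : v g - v 1 = (π g : V →L[ℂ] V) x - x := by
    have : v g = (π g : V →L[ℂ] V) (v 1) := by rw [hπ, mul_one]
    rw [this, hyx, map_add, (hW y).mp hy g hg]; abel
  rw [e]
  refine (norm_sub_le _ _).trans ?_
  rw [norm_unitary_apply, ← Submodule.coe_norm]
  linarith

/-! ### Relative property (T) for countable groups -/

section PositiveDefinite

variable {G : Type u} [Group G]

theorem IsPositiveDefinite.re_le_one {φ : G → ℂ} (hφ : IsPositiveDefinite φ) (h1 : φ 1 = 1)
    (g : G) : (φ g).re ≤ 1 := by
  obtain ⟨V, _, _, _, π, v, hv, -, -⟩ := hφ.exists_rep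
  have := norm_sub_sq_of_gram hv h1 1 g
  simp only [inv_one, one_mul] at this
  nlinarith [sq_nonneg ‖v 1 - v g‖]

/-- Translates of a point where `φ` is far from `1`, by points where `φ` is close to `1`, are
points where `φ` is far from `1`. -/
theorem IsPositiveDefinite.le_one_sub_re {φ : G → ℂ} (hφ : IsPositiveDefinite φ) (h1 : φ 1 = 1)
    {ε : ℝ} (hε : 0 < ε) {x y h : G} (hh : ε < ‖φ h - 1‖) (hx : ‖φ x - 1‖ ≤ ε ^ 2 / 32)
    (hy : ‖φ y - 1‖ ≤ ε ^ 2 / 32) : ε ^ 2 / 8 ≤ 1 - (φ (x⁻¹ * h * y)).re := by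
  obtain ⟨V, _, _, _, π, v, hv, hπ, -⟩ := hφ.exists_rep
  have hsmall : ∀ z, ‖φ z - 1‖ ≤ ε ^ 2 / 32 → ‖v z - v 1‖ ≤ ε / 4 := fun z hz =>
    le_of_sq_le_sq (by nlinarith [norm_sub_sq_le_of_gram hv h1 z]) (by positivity)
  have hy' : ‖v (h * y) - v h‖ ≤ ε / 4 := by
    have : v (h * y) - v h = (π h : V →L[ℂ] V) (v y - v 1) := by
      rw [map_sub, hπ, hπ, mul_one]
    rw [this, norm_unitary_apply]
    exact hsmall y hy
  have hfar : ε / 2 ≤ ‖v x - v (h * y)‖ := by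
    have h3 : v h - v 1 = (v x - v 1) - (v x - v (h * y)) - (v (h * y) - v h) := by abel
    have h4 : ‖v h - v 1‖ ≤ ‖v x - v 1‖ + ‖v x - v (h * y)‖ + ‖v (h * y) - v h‖ := by
      rw [h3]
      exact (norm_sub_le _ _).trans (by gcongr; exact norm_sub_le _ _)
    linarith [norm_sub_one_le_of_gram hv h1 h, hsmall x hx]
  have := norm_sub_sq_of_gram hv h1 x (h * y)
  rw [← mul_assoc] at this
  nlinarith

theorem IsPositiveDefinite.exp_neg_one_sub_re {φ : G → ℂ} (hφ : IsPositiveDefinite φ) {s : ℝ}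
    (hs : 0 ≤ s) : IsPositiveDefinite fun g => (Real.exp (-(s * (1 - (φ g).re))) : ℂ) := by
  have hre := ((hφ.add hφ.transpose).smul (a := ((s / 2 : ℝ) : ℂ))
    (Complex.zero_le_real.mpr (by positivity)))
  have := (posSemidef_const (X := G) (c := ((Real.exp (-s) : ℝ) : ℂ))
    (Complex.zero_le_real.mpr (by positivity))).hadamard (posSemidef_exp hre)
  unfold IsPositiveDefinite
  refine (congrArg Matrix.PosSemidef (Matrix.ext fun x y => ?_)).mpr this
  have hsymm : φ (y⁻¹ * x) = star (φ (x⁻¹ * y)) := (hφ.1.apply y x).symm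
  simp only [Matrix.of_apply, Matrix.hadamard_apply, Matrix.smul_apply, Matrix.add_apply,
    Matrix.transpose_apply, hsymm]
  rw [Complex.star_def, Complex.add_conj, Complex.ofReal_exp, Complex.ofReal_exp,
    ← Complex.exp_add]
  congr 1
  push_cast
  simp only [smul_eq_mul]
  ring

/-- Schoenberg's theorem for the functions `∑ cₙ (1 - Re φₙ)`. -/
theorem isPositiveDefinite_exp_neg_tsum {φ : ℕ → G → ℂ} (hφ : ∀ n, IsPositiveDefinite (φ n))
    {c : ℕ → ℝ} (hc : ∀ n, 0 ≤ c n) (hsum : ∀ g, Summable fun n => c n * (1 - (φ n g).re)) {t : ℝ}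
    (ht : 0 ≤ t) :
    IsPositiveDefinite fun g => (Real.exp (-(t * ∑' n, c n * (1 - (φ n g).re))) : ℂ) := by
  refine posSemidef_of_tendsto (l := atTop) (fun N => posSemidef_prod (Finset.range N) fun n =>
    (hφ n).exp_neg_one_sub_re (mul_nonneg ht (hc n))) fun x y => ?_
  simp only [Matrix.of_apply]
  have := ((hsum (x⁻¹ * y)).hasSum.tendsto_sum_nat.const_mul t).neg
  refine ((Complex.continuous_ofReal.comp Real.continuous_exp).tendsto _ |>.comp this).congr
    fun N => ?_
  simp only [Function.comp_apply, Finset.mul_sum, ← Finset.sum_neg_distrib, Real.exp_sum,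
    Complex.ofReal_prod, mul_assoc]

end PositiveDefinite

/-- If some sequence in `H` tends weakly to `0` on a total orbit `v`, then `V` has no nonzero
`H`-invariant vectors. -/
theorem eq_zero_of_tendsto_inner_zero {G V : Type*} [Group G] [NormedAddCommGroup V]
    [InnerProductSpace ℂ V] [CompleteSpace V] {H : Subgroup G} {π : G →* unitary (V →L[ℂ] V)}
    {v : G → V} (hπ : ∀ g x, (π g : V →L[ℂ] V) (v x) = v (g * x))
    (hd : Dense (Submodule.span ℂ (Set.range v) : Set V)) {h : ℕ → G} (hh : ∀ n, h n ∈ H)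
    (hlim : ∀ x y, Tendsto (fun n => inner ℂ (v x) (v (h n * y))) atTop (𝓝 0)) {η : V}
    (hη : ∀ k ∈ H, (π k : V →L[ℂ] V) η = η) : η = 0 := by
  have key : ∀ y, ∀ ζ : V, Tendsto (fun n => inner ℂ ζ (v (h n * y))) atTop (𝓝 0) := by
    intro y ζ
    have hbound : ∀ n, ‖v (h n * y)‖ = ‖v y‖ := fun n => by rw [← hπ, norm_unitary_apply]
    rw [Metric.tendsto_atTop]
    intro ε hε
    obtain ⟨ζ', hζ', hdist⟩ := hd.exists_dist_lt ζ (show 0 < ε / (2 * (‖v y‖ + 1)) by positivity)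
    have hspan : Tendsto (fun n => inner ℂ ζ' (v (h n * y))) atTop (𝓝 0) := by
      refine Submodule.span_induction (p := fun z _ =>
        Tendsto (fun n => inner ℂ z (v (h n * y))) atTop (𝓝 0)) ?_ ?_ ?_ ?_ hζ'
      · rintro _ ⟨x, rfl⟩
        exact hlim x y
      · simp
      · intro a b _ _ ha hb
        simpa [inner_add_left] using ha.add hb
      · intro c a _ ha
        simpa [inner_smul_left] using ha.mul_const (star c)
    obtain ⟨N, hN⟩ := Metric.tendsto_atTop.mp hspan (ε / 2) (by positivity)
    refine ⟨N, fun n hn => ?_⟩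
    have h1 := hN n hn
    rw [dist_zero_right] at h1 ⊢
    have h2 : inner ℂ ζ (v (h n * y)) =
        inner ℂ (ζ - ζ') (v (h n * y)) + inner ℂ ζ' (v (h n * y)) := by
      rw [← inner_add_left, sub_add_cancel]
    have h3 : ‖inner ℂ (ζ - ζ') (v (h n * y))‖ ≤ ε / 2 := by
      refine (norm_inner_le_norm _ _).trans ?_
      rw [hbound, ← dist_eq_norm]
      calc dist ζ ζ' * ‖v y‖ ≤ ε / (2 * (‖v y‖ + 1)) * (‖v y‖ + 1) := by gcongr; linarith
        _ = ε / 2 := by field_simp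
    rw [h2]
    exact (norm_add_le _ _).trans_lt (by linarith)
  have horth : ∀ y, inner ℂ η (v y) = 0 := fun y => by
    have hconst : ∀ n, inner ℂ η (v (h n * y)) = inner ℂ η (v y) := fun n => by
      conv_lhs => rw [← hη _ (hh n), ← hπ]
      exact ContinuousLinearMap.inner_map_map_of_mem_unitary (π (h n)).2 _ _
    refine tendsto_nhds_unique (tendsto_const_nhds (f := atTop (α := ℕ))) ((key y η).congr hconst)
  refine hd.eq_zero_of_inner_left ℂ fun z hz => ?_
  refine Submodule.span_induction (p := fun z _ => inner ℂ η z = 0) ?_ ?_ ?_ ?_ hz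
  · rintro _ ⟨x, rfl⟩; exact horth x
  · simp
  · intro a b _ _ ha hb; simp [ha, hb]
  · intro c a _ ha; simp [ha]

/-- For countable `G`, a failure of uniformity produces a function of negative type that is
unbounded on `H`, and with it representations with almost invariant vectors in which `H` is
mixing along a sequence. -/
theorem HasRelativePropertyT.positiveDefinite_of_countable {G : Type u} [Group G] [Countable G]
    {H : Subgroup G} (hT : HasRelativePropertyT H) : HasPositiveDefinitePropertyT H := by
  obtain ⟨δ, hδ, F, hinv⟩ := hT
  by_contra hcon
  simp only [HasPositiveDefinitePropertyT] at hcon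
  push Not at hcon
  obtain ⟨ε, hε, hcon⟩ := hcon
  obtain ⟨e, he⟩ := exists_surjective_nat G
  classical
  -- `φ n` is within `4⁻ⁿ` of `1` on the first `n` elements of `G`, but not within `ε` at `h n ∈ H`
  choose φ hφ h1 hF h hh hfar using fun n : ℕ =>
    hcon ((Finset.range (n + 1)).image e) ((1 / 4) ^ n) (by positivity)
  have hclose : ∀ g, ∀ᶠ n in atTop, ‖φ n g - 1‖ < (1 / 4) ^ n := fun g => by
    obtain ⟨k, rfl⟩ := he g
    filter_upwards [eventually_ge_atTop k] with n hn
    exact hF n _ (Finset.mem_image_of_mem _ (Finset.mem_range.mpr (by omega)))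
  have hnonneg : ∀ n g, 0 ≤ (2 : ℝ) ^ n * (1 - (φ n g).re) := fun n g =>
    mul_nonneg (by positivity) (by linarith [(hφ n).re_le_one (h1 n) g])
  have hsum : ∀ g, Summable fun n => (2 : ℝ) ^ n * (1 - (φ n g).re) := fun g => by
    refine Summable.of_norm_bounded_eventually_nat
      (summable_geometric_of_lt_one (r := (1 / 2 : ℝ)) (by norm_num) (by norm_num)) ?_
    filter_upwards [hclose g] with n hn
    rw [Real.norm_of_nonneg (hnonneg n g)]
    have h2 : 1 - (φ n g).re ≤ (1 / 4) ^ n := by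
      have := (Complex.abs_re_le_norm (φ n g - 1)).trans hn.le
      have h3 := neg_abs_le (φ n g - 1).re
      simp at this h3 ⊢
      linarith
    calc (2 : ℝ) ^ n * (1 - (φ n g).re) ≤ 2 ^ n * (1 / 4) ^ n := by gcongr
      _ = (1 / 2) ^ n := by rw [← mul_pow]; norm_num
  set ψ : G → ℝ := fun g => ∑' n, (2 : ℝ) ^ n * (1 - (φ n g).re) with hψ
  have hψ0 : ∀ g, 0 ≤ ψ g := fun g => tsum_nonneg fun n => hnonneg n g
  -- small enough for the cyclic vector of `exp(-tψ)` to be `(F, δ)`-invariant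
  set t : ℝ := δ ^ 2 / (2 * (1 + ∑ g ∈ F, ψ g)) with ht
  have hden : 0 < 1 + ∑ g ∈ F, ψ g := by
    have := Finset.sum_nonneg fun g (_ : g ∈ F) => hψ0 g
    linarith
  have ht0 : 0 < t := by positivity
  let Φ : G → ℂ := fun g => (Real.exp (-(t * ψ g)) : ℂ)
  have hΦ : IsPositiveDefinite Φ :=
    isPositiveDefinite_exp_neg_tsum hφ (c := fun n => 2 ^ n) (fun n => by positivity) hsum ht0.le
  have hone : Φ 1 = 1 := by simp [Φ, hψ, h1]
  obtain ⟨V, _, _, _, π, v, hv, hπ, hd⟩ := hΦ.exists_rep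
  obtain ⟨η, hη0, hη⟩ := hinv V π (v 1) (norm_eq_one_of_gram hv hone 1) fun g hg => by
    rw [hπ, mul_one, norm_sub_rev]
    refine lt_of_pow_lt_pow_left₀ 2 hδ.le ?_
    rw [norm_sub_sq_of_gram hv hone, inv_one, one_mul]
    have h2 := Real.add_one_le_exp (-(t * ψ g))
    have h3 : ψ g ≤ ∑ g ∈ F, ψ g := Finset.single_le_sum (fun g _ => hψ0 g) hg
    have h4 : 2 * (t * (1 + ∑ g ∈ F, ψ g)) = δ ^ 2 := by rw [ht]; field_simp
    have h5 : t * ψ g < t * (1 + ∑ g ∈ F, ψ g) := by gcongr; linarith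
    change 2 - 2 * Real.exp (-(t * ψ g)) < _
    linarith
  refine hη0 (eq_zero_of_tendsto_inner_zero hπ hd hh (fun x y => ?_) hη)
  simp only [hv]
  have hlarge : Tendsto (fun n => ψ (x⁻¹ * (h n * y))) atTop atTop := by
    refine tendsto_atTop_mono' atTop (f₁ := fun n => (2 : ℝ) ^ n * (ε ^ 2 / 8)) ?_
      ((tendsto_pow_atTop_atTop_of_one_lt (by norm_num)).atTop_mul_const (by positivity))
    have hsmall : ∀ᶠ n in atTop, (1 / 4 : ℝ) ^ n < ε ^ 2 / 32 :=
      (tendsto_pow_atTop_nhds_zero_of_lt_one (by norm_num) (by norm_num)).eventually_lt_const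
        (by positivity)
    filter_upwards [hclose x, hclose y, hsmall] with n hx hy hs
    refine le_trans ?_ ((hsum _).le_tsum n fun m _ => hnonneg m _)
    gcongr
    rw [← mul_assoc]
    exact (hφ n).le_one_sub_re (h1 n) hε (hfar n) (hx.trans hs).le (hy.trans hs).le
  have := Real.tendsto_exp_neg_atTop_nhds_zero.comp (hlarge.const_mul_atTop ht0)
  have hlim := (Complex.continuous_ofReal.tendsto 0).comp this
  rw [Complex.ofReal_zero] at hlim
  exact hlim

/-! ### Circumcentres in projective Hilbert space -/

section Circumcentre

variable {V : Type*} [NormedAddCommGroup V] [InnerProductSpace ℂ V]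

/-- For unit vectors `η`, `η'` in the same phase, both far from being orthogonal to `v`, the inner
products with `v` differ by a definite factor less than `‖η - η'‖`. The reason is that
`⟨η, η - η'⟩` is only of second order in `‖η - η'‖`. -/
theorem norm_inner_sub_sq_le {v η η' : V} (hv : ‖v‖ = 1) (hη : ‖η‖ = 1) (hη' : ‖η'‖ = 1) {c : ℝ}
    (hc : 0 ≤ c) (hcη : inner ℂ η η' = (c : ℂ)) (hvη : 0.99 ≤ ‖inner ℂ v η‖) :
    ‖inner ℂ v (η - η')‖ ^ 2 ≤ 3 / 4 * ‖η - η'‖ ^ 2 := by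
  have hd := norm_sub_sq_eq_of_norm_eq_one hη hη'
  rw [hcη, Complex.ofReal_re] at hd
  set d := ‖η - η'‖ with hd_def
  have hd0 : 0 ≤ d := norm_nonneg _
  obtain ⟨u, hu, huz⟩ := RCLike.exists_norm_eq_mul_self (inner ℂ v η)
  -- rotate `v` so that its inner product with `η` is positive
  set w := star u • v with hw
  have hwn : ‖w‖ = 1 := by rw [hw, norm_smul, norm_star, hu, hv, one_mul]
  have hwi : ∀ z, inner ℂ w z = u * inner ℂ v z := fun z => by
    rw [hw, inner_smul_left]; simp
  have hws := norm_sub_sq_eq_of_norm_eq_one hwn hη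
  rw [hwi, ← huz] at hws
  simp only [Complex.coe_algebraMap, Complex.ofReal_re] at hws
  set s := ‖w - η‖ with hs_def
  have hs0 : 0 ≤ s := norm_nonneg _
  have h1 : inner ℂ η (η - η') = ((1 - c : ℝ) : ℂ) := by
    rw [inner_sub_right, hcη, inner_self_eq_norm_sq_to_K, hη]
    simp
  have h2 : ‖inner ℂ v (η - η')‖ ≤ s * d + d ^ 2 / 2 := by
    have h3 : ‖inner ℂ v (η - η')‖ = ‖inner ℂ w (η - η')‖ := by
      rw [hwi, norm_mul, hu, one_mul]
    have h4 : inner ℂ w (η - η') = inner ℂ (w - η) (η - η') + inner ℂ η (η - η') := by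
      rw [← inner_add_left, sub_add_cancel]
    rw [h3, h4]
    refine (norm_add_le _ _).trans (add_le_add (norm_inner_le_norm _ _) ?_)
    rw [h1, Complex.norm_real, Real.norm_of_nonneg (by nlinarith [sq_nonneg d])]
    linarith
  have h5 : (s + d / 2) ^ 2 ≤ 3 / 4 := by
    nlinarith [sq_nonneg (10 * s - d)]
  calc ‖inner ℂ v (η - η')‖ ^ 2 ≤ (s * d + d ^ 2 / 2) ^ 2 := by gcongr
    _ = (s + d / 2) ^ 2 * d ^ 2 := by ring
    _ ≤ 3 / 4 * d ^ 2 := by gcongr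

/-- Unit vectors in the same phase that nearly maximize `inf_x |⟨v_x, ·⟩|` are close to each other:
otherwise the value at their normalized midpoint would exceed the supremum `R`, by the parallelogram
law and because the factor `3 / 4` of `norm_inner_sub_sq_le` is less than `R ^ 2`. -/
theorem norm_sub_sq_le_of_near_maximal {X : Type*} {v : X → V} (hv : ∀ x, ‖v x‖ = 1) {R r : ℝ}
    (hr : 0.99 ≤ r) (hrR : r ≤ R)
    (hR : ∀ ζ : V, ‖ζ‖ = 1 → ∀ ρ : ℝ, 0 ≤ ρ → (∀ x, ρ ≤ ‖inner ℂ (v x) ζ‖) → ρ ≤ R)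
    {η η' : V} (hη : ‖η‖ = 1) (hη' : ‖η'‖ = 1) {c : ℝ}
    (hc : 0 ≤ c) (hcη : inner ℂ η η' = (c : ℂ)) (hrη : ∀ x, r ≤ ‖inner ℂ (v x) η‖)
    (hrη' : ∀ x, r ≤ ‖inner ℂ (v x) η'‖) : ‖η - η'‖ ^ 2 ≤ 20 * (R ^ 2 - r ^ 2) := by
  have hd := norm_sub_sq_eq_of_norm_eq_one hη hη'
  rw [hcη, Complex.ofReal_re] at hd
  have hm : ‖η + η'‖ ^ 2 = 4 - ‖η - η'‖ ^ 2 := by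
    have := parallelogram_law_with_norm ℂ η η'
    rw [hη, hη'] at this
    linarith
  set d := ‖η - η'‖
  set m := ‖η + η'‖
  have hm0 : 0 < m := by
    have : 0 ≤ m := norm_nonneg _
    by_contra! h
    have : m = 0 := le_antisymm h this
    rw [this] at hm
    nlinarith
  have hpos : 0 ≤ 4 * r ^ 2 - 3 / 4 * d ^ 2 := by nlinarith
  have hmid : ∀ x, 4 * r ^ 2 - 3 / 4 * d ^ 2 ≤ ‖inner ℂ (v x) (η + η')‖ ^ 2 := fun x => by
    have h1 := norm_inner_sub_sq_le (hv x) hη hη' hc hcη (hr.trans (hrη x))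
    have h2 := parallelogram_law_with_norm ℂ (inner ℂ (v x) η) (inner ℂ (v x) η')
    rw [← inner_add_right, ← inner_sub_right] at h2
    have h3 := hrη x
    have h4 := hrη' x
    nlinarith
  have h5 : √(4 * r ^ 2 - 3 / 4 * d ^ 2) / m ≤ R := by
    refine hR (((m⁻¹ : ℝ) : ℂ) • (η + η')) ?_ _ (by positivity) fun x => ?_
    · rw [norm_smul, Complex.norm_real, Real.norm_of_nonneg (by positivity),
        inv_mul_cancel₀ hm0.ne']
    · rw [inner_smul_right, norm_mul, Complex.norm_real, Real.norm_of_nonneg (by positivity),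
        div_eq_inv_mul]
      gcongr
      exact Real.sqrt_le_iff.mpr ⟨norm_nonneg _, hmid x⟩
  rw [div_le_iff₀ hm0, Real.sqrt_le_left (by nlinarith), mul_pow, hm] at h5
  have hR2 : 0 ≤ R ^ 2 - 0.95 := by nlinarith
  nlinarith [mul_nonneg hR2 (sq_nonneg d)]

/-- Near maximizers of `inf_x |⟨v_x, ·⟩|` are close to each other up to a phase. -/
theorem exists_phase_norm_sub_sq_le {X : Type*} {v : X → V} (hv : ∀ x, ‖v x‖ = 1) {R r : ℝ}
    (hr : 0.99 ≤ r) (hrR : r ≤ R)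
    (hR : ∀ ζ : V, ‖ζ‖ = 1 → ∀ ρ : ℝ, 0 ≤ ρ → (∀ x, ρ ≤ ‖inner ℂ (v x) ζ‖) → ρ ≤ R)
    {η η' : V} (hη : ‖η‖ = 1) (hη' : ‖η'‖ = 1) (hrη : ∀ x, r ≤ ‖inner ℂ (v x) η‖)
    (hrη' : ∀ x, r ≤ ‖inner ℂ (v x) η'‖) :
    ∃ u : ℂ, ‖u‖ = 1 ∧ ‖η - u • η'‖ ^ 2 ≤ 20 * (R ^ 2 - r ^ 2) := by
  obtain ⟨u, hu, huz⟩ := RCLike.exists_norm_eq_mul_self (inner ℂ η η')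
  refine ⟨u, hu, norm_sub_sq_le_of_near_maximal hv hr hrR hR hη ?_
    (norm_nonneg (inner ℂ η η')) ?_ hrη fun x => ?_⟩
  · rw [norm_smul, hu, hη', one_mul]
  · rw [inner_smul_right]; exact huz.symm
  · rw [inner_smul_right, norm_mul, hu, one_mul]; exact hrη' x

/-- A family of lines in a Hilbert space which are pairwise close has a circumcentre, which every
isometry permuting the family fixes. -/
theorem exists_circumcentre [CompleteSpace V] {X : Type*} [Nonempty X] {v : X → V}
    (hv : ∀ x, ‖v x‖ = 1) (hclose : ∀ x y, 0.99 ≤ ‖inner ℂ (v x) (v y)‖) :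
    ∃ η : V, ‖η‖ = 1 ∧ ∀ U : V →ₗᵢ[ℂ] V, (∀ x, ∃ y, ∃ c : ℂ, ‖c‖ = 1 ∧ U (v y) = c • v x) →
      ∃ χ : ℂ, ‖χ‖ = 1 ∧ U η = χ • η := by
  obtain ⟨x₀⟩ := ‹Nonempty X›
  let S : Set ℝ := {r | 0.99 ≤ r ∧ ∃ η : V, ‖η‖ = 1 ∧ ∀ x, r ≤ ‖inner ℂ (v x) η‖}
  have hSne : S.Nonempty := ⟨0.99, le_rfl, v x₀, hv x₀, fun x => hclose x x₀⟩
  have hSbdd : BddAbove S := ⟨1, by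
    rintro r ⟨-, η, hη, hr⟩
    refine (hr x₀).trans ((norm_inner_le_norm _ _).trans ?_)
    rw [hη, hv, one_mul]⟩
  obtain ⟨r, hrmono, hrlim, hrS⟩ := exists_seq_tendsto_sSup hSne hSbdd
  set R := sSup S
  have hrR : ∀ n, r n ≤ R := fun n => le_csSup hSbdd (hrS n)
  have hr99 : ∀ n, 0.99 ≤ r n := fun n => (hrS n).1
  have hR : ∀ ζ : V, ‖ζ‖ = 1 → ∀ ρ : ℝ, 0 ≤ ρ → (∀ x, ρ ≤ ‖inner ℂ (v x) ζ‖) → ρ ≤ R := by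
    intro ζ hζ ρ _ hρ
    rcases le_total 0.99 ρ with h | h
    · exact le_csSup hSbdd ⟨h, ζ, hζ, hρ⟩
    · exact h.trans ((hr99 0).trans (hrR 0))
  -- near maximizers, normalized to have positive inner product with `v x₀`
  have hex : ∀ n, ∃ η : V, ‖η‖ = 1 ∧ (∀ x, r n ≤ ‖inner ℂ (v x) η‖) ∧
      inner ℂ (v x₀) η = (‖inner ℂ (v x₀) η‖ : ℂ) := fun n => by
    obtain ⟨-, η, hη, hrη⟩ := hrS n
    obtain ⟨u, hu, huz⟩ := RCLike.exists_norm_eq_mul_self (inner ℂ (v x₀) η)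
    refine ⟨u • η, by rw [norm_smul, hu, hη, one_mul], fun x => ?_, ?_⟩
    · rw [inner_smul_right, norm_mul, hu, one_mul]; exact hrη x
    · rw [inner_smul_right, norm_mul, hu, one_mul]; exact huz.symm
  choose η hη hrη hphase using hex
  have hcauchy : CauchySeq η := by
    refine cauchySeq_of_le_tendsto_0 (fun N => 4 * √(20 * (R ^ 2 - r N ^ 2))) ?_ ?_
    · intro n m N hn hm
      obtain ⟨u, hu, hd⟩ := exists_phase_norm_sub_sq_le hv (hr99 N) (hrR N) hR (hη n) (hη m)
        (fun x => (hrmono hn).trans (hrη n x)) (fun x => (hrmono hm).trans (hrη m x))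
      set D := √(20 * (R ^ 2 - r N ^ 2)) with hD
      have hd' : ‖η n - u • η m‖ ≤ D := Real.le_sqrt_of_sq_le hd
      set a := ‖inner ℂ (v x₀) (η n)‖ with ha
      set b := ‖inner ℂ (v x₀) (η m)‖ with hb
      have hb99 : 0.99 ≤ b := (hr99 m).trans (hrη m x₀)
      have hab : ‖(a : ℂ) - u * b‖ ≤ D := by
        rw [← hphase n, ← hphase m, ← inner_smul_right, ← inner_sub_right]
        refine (norm_inner_le_norm _ _).trans ?_
        rw [hv, one_mul]; exact hd'
      have hab' : |a - b| ≤ D := by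
        refine le_trans ?_ hab
        have := abs_norm_sub_norm_le (a : ℂ) (u * b)
        rwa [norm_mul, hu, one_mul, Complex.norm_real, Complex.norm_real,
          Real.norm_of_nonneg (norm_nonneg _), Real.norm_of_nonneg (norm_nonneg _)] at this
      have hu1 : ‖u - 1‖ * b ≤ 2 * D := by
        have h1 : ‖u - 1‖ * b = ‖(u - 1) * b‖ := by
          rw [norm_mul, Complex.norm_real, Real.norm_of_nonneg (norm_nonneg _)]
        have h2 : (u - 1) * b = -((a : ℂ) - u * b) + ((a - b : ℝ) : ℂ) := by push_cast; ring
        rw [h1, h2]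
        refine (norm_add_le _ _).trans ?_
        rw [norm_neg, Complex.norm_real, Real.norm_eq_abs]
        linarith
      have hu2 : ‖u - 1‖ ≤ 3 * D := by
        nlinarith [norm_nonneg (u - 1), Real.sqrt_nonneg (20 * (R ^ 2 - r N ^ 2))]
      rw [dist_eq_norm]
      have h3 : η n - η m = (η n - u • η m) + (u - 1) • η m := by
        rw [sub_smul, one_smul]; abel
      rw [h3]
      refine (norm_add_le _ _).trans ?_
      rw [norm_smul, hη, mul_one]
      linarith
    · have : Tendsto (fun N => 4 * √(20 * (R ^ 2 - r N ^ 2))) atTop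
          (𝓝 (4 * √(20 * (R ^ 2 - R ^ 2)))) :=
        (((hrlim.pow 2).const_sub _).const_mul _).sqrt.const_mul _
      simpa using this
  obtain ⟨ζ, hζ⟩ := cauchySeq_tendsto_of_complete hcauchy
  have hζn : ‖ζ‖ = 1 := tendsto_nhds_unique hζ.norm (by simp [hη])
  have hζR : ∀ x, R ≤ ‖inner ℂ (v x) ζ‖ := fun x =>
    le_of_tendsto_of_tendsto' hrlim ((tendsto_const_nhds.inner hζ).norm) fun n => hrη n x
  refine ⟨ζ, hζn, fun U hU => ?_⟩
  obtain ⟨u, hu, hd⟩ := exists_phase_norm_sub_sq_le hv ((hr99 0).trans (hrR 0)) le_rfl hR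
    (η := U ζ) (η' := ζ) (by rw [U.norm_map, hζn]) hζn (fun x => by
      obtain ⟨y, c, hc, hy⟩ := hU x
      have : ‖inner ℂ (v x) (U ζ)‖ = ‖inner ℂ (v y) ζ‖ := by
        rw [← U.inner_map_map (v y), hy, inner_smul_left, norm_mul, RCLike.norm_conj, hc, one_mul]
      rw [this]
      exact hζR y) hζR
  refine ⟨u, hu, ?_⟩
  rw [sub_self, mul_zero] at hd
  exact sub_eq_zero.mp (norm_eq_zero.mp (pow_eq_zero_iff two_ne_zero |>.mp
    (le_antisymm hd (sq_nonneg _))))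

end Circumcentre

/-! ### Kernels that are invariant up to a cocycle -/

theorem Circle.star_coe_mul_coe (z : Circle) : star (z : ℂ) * z = 1 := by
  rw [Complex.star_def, ← Circle.coe_inv_eq_conj, ← Circle.coe_mul, inv_mul_cancel, Circle.coe_one]

/-- A 2-cocycle is a coboundary if it is the cocycle of a projective representation with a vector
whose orbit consists of pairwise close lines: the circumcentre of the orbit is an invariant line. -/
theorem mem_scalarTwoCoboundaries_of_kernel {G : Type u} [Group G] {c : G → G → Circle}
    (hc : c ∈ scalarTwoCocycles G) {K : Matrix G G ℂ} (hK : K.PosSemidef) (hone : ∀ x, K x x = 1)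
    (hinv : ∀ g x y, K (g * x) (g * y) = c g x * star (c g y : ℂ) * K x y)
    (hclose : ∀ x y, 0.99 ≤ ‖K x y‖) : c ∈ scalarTwoCoboundaries G := by
  obtain ⟨V, _, _, _, v, hv, hd⟩ := exists_gram_of_posSemidef hK
  have hnorm : ∀ x, ‖v x‖ = 1 := fun x => by
    have := inner_self_eq_norm_sq_to_K (𝕜 := ℂ) (v x)
    rw [hv, hone] at this
    have h2 : ‖v x‖ ^ 2 = 1 := Complex.ofReal_injective (by push_cast; exact this.symm)
    exact (pow_eq_one_iff_of_nonneg (norm_nonneg _) two_ne_zero).mp h2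
  have hU : ∀ g, ∃ U : V →ₗᵢ[ℂ] V, ∀ x, U (v x) = (c g x : ℂ) • v (g * x) := fun g =>
    exists_linearIsometry_of_inner_eq (w := fun x => (c g x : ℂ) • v (g * x)) hd fun x y => by
      rw [inner_smul_left, inner_smul_right, hv, hv, hinv, ← Complex.star_def]
      linear_combination (-K x y) * ((star (c g x : ℂ) * c g x) *
        Circle.star_coe_mul_coe (c g y) + Circle.star_coe_mul_coe (c g x))
  choose U hUv using hU
  obtain ⟨η, hη, hfix⟩ := exists_circumcentre hnorm fun x y => by rw [hv]; exact hclose x y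
  choose χ hχ hχη using fun g => hfix (U g) fun x =>
    ⟨g⁻¹ * x, c g (g⁻¹ * x), Circle.norm_coe _, by rw [hUv, mul_inv_cancel_left]⟩
  -- `U` is a projective representation with cocycle `c`, so its eigenvalues on `η` trivialize `c`
  have hcomp : ∀ g h, U g (U h η) = (c g h : ℂ) • U (g * h) η := fun g h => by
    have : (U g).toContinuousLinearMap ∘L (U h).toContinuousLinearMap
        = (c g h : ℂ) • (U (g * h)).toContinuousLinearMap := by
      refine ContinuousLinearMap.ext_on hd ?_
      rintro _ ⟨x, rfl⟩
      have := congrArg (fun z : Circle => (z : ℂ)) (hc g h x)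
      simp only [Circle.coe_mul] at this
      simp only [ContinuousLinearMap.comp_apply, LinearIsometry.coe_toContinuousLinearMap,
        FunLike.coe_smul, Pi.smul_apply, hUv, map_smul, smul_smul, mul_assoc]
      rw [this]
    exact DFunLike.congr_fun this η
  have hlift : ∀ g, ∃ z : Circle, (z : ℂ) = χ g := fun g =>
    ⟨⟨χ g, mem_sphere_zero_iff_norm.mpr (hχ g)⟩, rfl⟩
  choose l hl using hlift
  refine ⟨l, fun g h => ?_⟩
  rw [eq_mul_inv_iff_mul_eq]
  apply Circle.ext
  have hne : η ≠ 0 := norm_ne_zero_iff.mp (by rw [hη]; exact one_ne_zero)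
  have := hcomp g h
  rw [hχη, hχη, map_smul, hχη, smul_smul, smul_smul] at this
  have := smul_left_injective ℂ hne this
  simp only [Circle.coe_mul, hl]
  exact this.symm.trans (mul_comm _ _)

/-! ### Comparison of two projective representations -/

section Trace

variable {A : Type*} [Ring A] [StarRing A] [Algebra ℂ A]

variable {G : Type u} [Group G]

/-- A projective representation of `G` by unitaries of the corner `p A p`, with 2-cocycle `μ`. -/
structure IsCornerRep (p : A) (μ : G → G → Circle) (u : G → A) : Prop where
  star_mul_self : ∀ g, star (u g) * u g = p
  mul_star_self : ∀ g, u g * star (u g) = p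
  left : ∀ g, p * u g = u g
  mul : ∀ g h, u g * u h = (μ g h : ℂ) • u (g * h)

namespace IsCornerRep

variable {p : A} {μ : G → G → Circle} {u : G → A}

theorem star_right (hu : IsCornerRep p μ u) (g : G) : star (u g) * p = star (u g) := by
  rw [← hu.mul_star_self g, ← mul_assoc, hu.star_mul_self]
  have := congrArg star (hu.left g)
  rw [star_mul, ← hu.mul_star_self g] at this
  simpa only [star_mul, star_star, ← mul_assoc, hu.star_mul_self] using this

theorem apply_one (hu : IsCornerRep p μ u) : u 1 = (μ 1 1 : ℂ) • p := by
  have h := congrArg (· * star (u 1)) (hu.mul 1 1)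
  simp only [mul_assoc, hu.mul_star_self, mul_one, smul_mul_assoc] at h
  rw [← h, ← hu.star_mul_self 1, ← mul_assoc, hu.mul_star_self, hu.left]

end IsCornerRep

variable [StarModule ℂ A] {τ : A →ₗ[ℂ] ℂ}

/-- Positive functionals are Hermitian, by polarization. -/
theorem star_apply_star_mul (hpos : ∀ x, 0 ≤ τ (star x * x)) (x y : A) :
    star (τ (star x * y)) = τ (star y * x) := by
  have h := fun z => (Complex.nonneg_iff.mp (hpos z)).2
  have h1 := h (x + y)
  have h2 := h (x + Complex.I • y)
  have hx := h x
  have hy := h y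
  simp only [star_add, star_smul, add_mul, mul_add, map_add, smul_mul_assoc, mul_smul_comm,
    map_smul, smul_eq_mul, Complex.add_im, Complex.mul_im, Complex.I_re, Complex.I_im,
    Complex.star_def, Complex.conj_I, Complex.neg_re, Complex.neg_im, Complex.mul_re] at h1 h2
  apply Complex.ext
  · simp only [Complex.star_def, Complex.conj_re]
    linarith
  · simp only [Complex.star_def, Complex.conj_im]
    linarith

theorem posSemidef_of_positive_functional {X : Type*} (hpos : ∀ x, 0 ≤ τ (star x * x))
    (v : X → A) :
    (Matrix.of fun x y => τ (star (v x) * v y)).PosSemidef := by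
  refine ⟨?_, fun f => ?_⟩
  · ext x y
    exact star_apply_star_mul hpos _ _
  · have : (f.sum fun x a => f.sum fun y b => star a * τ (star (v x) * v y) * b)
        = τ (star (f.sum fun x a => a • v x) * f.sum fun x a => a • v x) := by
      simp only [Finsupp.sum, star_sum, Finset.sum_mul, Finset.mul_sum, map_sum, star_smul,
        smul_mul_assoc, mul_smul_comm, map_smul, smul_eq_mul]
      rw [Finset.sum_comm]
      refine Finset.sum_congr rfl fun x _ => Finset.sum_congr rfl fun y _ => ?_
      ring
    simp only [Matrix.of_apply]
    rw [this]
    exact hpos _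

namespace IsCornerRep

variable {p q : A} {μ ν : G → G → Circle} {u w : G → A}

theorem mul_mul_star (hu : IsCornerRep p μ u) (hw : IsCornerRep q ν w) (g x : G) :
    u g * (u x * star (w x)) * star (w g)
      = ((μ g x * (ν g x)⁻¹ : Circle) : ℂ) • (u (g * x) * star (w (g * x))) := by
  have : u g * (u x * star (w x)) * star (w g) = (u g * u x) * star (w g * w x) := by
    rw [star_mul]; simp only [mul_assoc]
  rw [this, hu.mul, hw.mul, star_smul, smul_mul_smul_comm, Circle.coe_mul, Circle.coe_inv_eq_conj]
  rfl

/-- The kernel `τ(v_x* v_y)`, `v_x = u(x) w(x)*`, is invariant up to the quotient of the two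
cocycles. -/
theorem kernel_mul_mul (hu : IsCornerRep p μ u) (hw : IsCornerRep q ν w)
    (htr : ∀ x y, τ (x * y) = τ (y * x)) (g x y : G) :
    τ (star (u (g * x) * star (w (g * x))) * (u (g * y) * star (w (g * y))))
      = ((μ g x * (ν g x)⁻¹ : Circle) : ℂ) * star ((μ g y * (ν g y)⁻¹ : Circle) : ℂ)
        * τ (star (u x * star (w x)) * (u y * star (w y))) := by
  have h1 : τ (star (u g * (u x * star (w x)) * star (w g)) *
        (u g * (u y * star (w y)) * star (w g)))
      = τ (star (u x * star (w x)) * (u y * star (w y))) := by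
    have e1 : star (u g * (u x * star (w x)) * star (w g)) *
          (u g * (u y * star (w y)) * star (w g))
        = w g * (star (u x * star (w x)) * (star (u g) * u g) * (u y * star (w y)) *
          star (w g)) := by
      simp only [star_mul, star_star, mul_assoc]
    rw [e1, htr, hu.star_mul_self]
    have e2 : star (u x * star (w x)) * p * (u y * star (w y)) * star (w g) * w g
        = star (u x * star (w x)) * ((p * u y) * (star (w y) * (star (w g) * w g))) := by
      simp only [mul_assoc]
    rw [e2, hu.left, hw.star_mul_self, hw.star_right]
  rw [← h1, hu.mul_mul_star hw, hu.mul_mul_star hw, star_smul, smul_mul_smul_comm, map_smul,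
    smul_eq_mul]
  set T := τ (star (u (g * x) * star (w (g * x))) * (u (g * y) * star (w (g * y))))
  set a := μ g x * (ν g x)⁻¹
  set b := μ g y * (ν g y)⁻¹
  linear_combination (-T) *
    ((star (a : ℂ) * a) * Circle.star_coe_mul_coe b + Circle.star_coe_mul_coe a)

theorem kernel_one (hu : IsCornerRep p μ u) (hw : IsCornerRep q ν w)
    (htr : ∀ x y, τ (x * y) = τ (y * x)) (y : G) :
    τ (star (u 1 * star (w 1)) * (u y * star (w y)))
      = star ((μ 1 1 * (ν 1 1)⁻¹ : Circle) : ℂ) * τ (u y * star (w y)) := by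
  have hq : star q = q := by rw [← hw.mul_star_self 1, star_mul, star_star]
  have hp : star p = p := by rw [← hu.mul_star_self 1, star_mul, star_star]
  have h1 : u 1 * star (w 1) = ((μ 1 1 * (ν 1 1)⁻¹ : Circle) : ℂ) • (p * q) := by
    rw [hu.apply_one, hw.apply_one, star_smul, smul_mul_smul_comm, hq, Circle.coe_mul,
      Circle.coe_inv_eq_conj]
    rfl
  rw [h1, star_smul, star_mul, hq, hp, smul_mul_assoc, map_smul, smul_eq_mul]
  congr 1
  have e : q * p * (u y * star (w y)) = q * ((p * u y) * star (w y)) := by simp only [mul_assoc]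
  rw [e, hu.left, htr, mul_assoc, hw.star_right]

/-- If two projective representations are close, in the sense that `τ (u g * star (w g))` is close
to `1` on a suitable finite set, then their 2-cocycles are cohomologous on `H`. -/
theorem mem_coboundaries (hu : IsCornerRep p μ u) (hw : IsCornerRep q ν w)
    (hμ : μ ∈ scalarTwoCocycles G) (hν : ν ∈ scalarTwoCocycles G)
    (hpos : ∀ x, 0 ≤ τ (star x * x)) (htr : ∀ x y, τ (x * y) = τ (y * x))
    {H : Subgroup G} {F : Finset G} {δ : ℝ}
    (hF : ∀ φ : G → ℂ, IsPositiveDefinite φ → φ 1 = 1 → (∀ g ∈ F, ‖φ g - 1‖ < δ) →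
      ∀ h ∈ H, ‖φ h - 1‖ ≤ 0.01)
    {δ' : ℝ} (hδ' : δ' ≤ 1 / 4) (hδδ' : 10 * δ' ≤ δ)
    (h1 : ‖τ (u 1 * star (w 1)) - 1‖ < δ') (hclose : ∀ g ∈ F, ‖τ (u g * star (w g)) - 1‖ < δ') :
    (fun g h : H => μ g h * (ν g h)⁻¹) ∈ scalarTwoCoboundaries H := by
  set s : G → ℂ := fun g => τ (u g * star (w g)) with hs
  set c : G → G → Circle := fun g h => μ g h * (ν g h)⁻¹ with hc
  have hcmem : c ∈ scalarTwoCocycles G :=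
    (scalarTwoCocycles G).mul_mem hμ ((scalarTwoCocycles G).inv_mem hν)
  set k : Matrix G G ℂ :=
    Matrix.of fun x y => τ (star (u x * star (w x)) * (u y * star (w y))) with hk
  have hkpsd : k.PosSemidef := posSemidef_of_positive_functional hpos _
  have hkinv : ∀ g x y, k (g * x) (g * y) = c g x * star (c g y : ℂ) * k x y :=
    hu.kernel_mul_mul hw htr
  have hnorm1 : ∀ z : Circle, ‖star (z : ℂ)‖ = 1 := fun z => by rw [norm_star, Circle.norm_coe]
  have hknorm : ∀ x y, ‖k x y‖ = ‖s (x⁻¹ * y)‖ := fun x y => by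
    have h2 := hkinv x 1 (x⁻¹ * y)
    rw [mul_one, mul_inv_cancel_left] at h2
    rw [h2, norm_mul, norm_mul, hnorm1, Circle.norm_coe, one_mul, one_mul]
    change ‖τ _‖ = _
    rw [hu.kernel_one hw htr, norm_mul, hnorm1, one_mul]
  set a : ℝ := ‖s 1‖ with ha
  have hnear : ∀ z : ℂ, ‖z - 1‖ < δ' → |‖z‖ - 1| < δ' := fun z hz => by
    have := abs_norm_sub_norm_le z 1
    rw [norm_one] at this
    exact this.trans_lt hz
  have ha1 := abs_lt.mp (hnear _ h1)
  have ha0 : 0 < a := by linarith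
  have hkdiag : ∀ x, k x x = a := fun x => by
    have h2 : k x x = ‖k x x‖ := (Complex.norm_of_nonneg' (hkpsd.diag_nonneg (i := x))).symm
    rw [h2, hknorm, inv_mul_cancel]
  -- the positive definite function `|s|² / a²`
  set φ : G → ℂ := fun g => ((‖s g‖ ^ 2 / a ^ 2 : ℝ) : ℂ) with hφ
  have hφpd : IsPositiveDefinite φ := by
    have h2 := (hkpsd.hadamard hkpsd.transpose).smul (a := ((1 / a ^ 2 : ℝ) : ℂ))
      (Complex.zero_le_real.mpr (by positivity))
    refine (congrArg Matrix.PosSemidef (Matrix.ext fun x y => ?_)).mpr h2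
    have h3 : k y x = star (k x y) := (hkpsd.1.apply y x).symm
    simp only [Matrix.of_apply, Matrix.smul_apply, Matrix.hadamard_apply, Matrix.transpose_apply]
    rw [h3, Complex.star_def, Complex.mul_conj, Complex.normSq_eq_norm_sq, hknorm, smul_eq_mul,
      ← Complex.ofReal_mul]
    simp only [hφ]
    congr 1
    ring
  have hφ1 : φ 1 = 1 := by
    simp only [hφ]
    rw [← ha, div_self (by positivity), Complex.ofReal_one]
  have hφF : ∀ g ∈ F, ‖φ g - 1‖ < δ := fun g hg => by
    have hb := abs_lt.mp (hnear _ (hclose g hg))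
    set b := ‖s g‖
    have h2 : φ g - 1 = (((b ^ 2 - a ^ 2) / a ^ 2 : ℝ) : ℂ) := by
      simp only [hφ]
      push_cast
      rw [sub_div, div_self (by exact_mod_cast (pow_pos ha0 2).ne')]
    rw [h2, Complex.norm_real, Real.norm_eq_abs, abs_div, abs_of_pos (pow_pos ha0 2),
      div_lt_iff₀ (by positivity), abs_lt]
    have h3 : 9 / 16 ≤ a ^ 2 := by nlinarith
    constructor <;> nlinarith
  have hH := hF φ hφpd hφ1 hφF
  let K : Matrix H H ℂ := (((a⁻¹ : ℝ) : ℂ) • k).submatrix (↑) (↑)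
  have hKapply : ∀ x y : H, K x y = ((a⁻¹ : ℝ) : ℂ) * k x y := fun _ _ => rfl
  refine mem_scalarTwoCoboundaries_of_kernel (K := K) (fun x y z => hcmem x y z)
    ((hkpsd.smul (Complex.zero_le_real.mpr (by positivity))).submatrix _) (fun x => ?_)
    (fun g x y => ?_) fun x y => ?_
  · rw [hKapply, hkdiag, ← Complex.ofReal_mul, inv_mul_cancel₀ ha0.ne', Complex.ofReal_one]
  · rw [hKapply, hKapply, Subgroup.coe_mul, Subgroup.coe_mul, hkinv]
    ring
  · have h2 := hH (x⁻¹ * y : H) (x⁻¹ * y : H).2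
    have h3 : φ (x⁻¹ * y : H) - 1 = ((‖K x y‖ ^ 2 - 1 : ℝ) : ℂ) := by
      rw [hKapply, norm_mul, hknorm, Complex.norm_real, Real.norm_of_nonneg (by positivity)]
      simp only [hφ, Subgroup.coe_mul, Subgroup.coe_inv]
      push_cast
      ring
    rw [h3, Complex.norm_real, Real.norm_eq_abs] at h2
    have h4 := (abs_le.mp h2).1
    refine le_of_sq_le_sq (a := (0.99 : ℝ)) ?_ (norm_nonneg _)
    norm_num at h4 ⊢
    linarith

end IsCornerRep

end Trace

/-! ### Normal traces and separability -/

/-- In a separable space, if points with nearby images under `f` have the same image under `κ`,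
then `κ` takes countably many values. -/
theorem countable_image_of_dist_lt {J X Y : Type*} [PseudoMetricSpace X]
    [TopologicalSpace.SeparableSpace X] (f : J → X) (κ : J → Y) (s : Set J) {ε : ℝ} (hε : 0 < ε)
    (h : ∀ i ∈ s, ∀ j ∈ s, dist (f i) (f j) < ε → κ i = κ j) : (κ '' s).Countable := by
  obtain ⟨t, htc, htd⟩ := TopologicalSpace.exists_countable_dense X
  refine Set.Countable.mono (s₂ := ⋃ d ∈ t, κ '' {i ∈ s | dist (f i) d < ε / 2}) ?_
    (htc.biUnion fun d _ => Set.Subsingleton.countable ?_)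
  · rintro _ ⟨i, hi, rfl⟩
    obtain ⟨d, hd, hdi⟩ := htd.exists_dist_lt (f i) (half_pos hε)
    exact Set.mem_biUnion hd ⟨i, ⟨hi, hdi⟩, rfl⟩
  · rintro _ ⟨i, ⟨hi, hid⟩, rfl⟩ _ ⟨j, ⟨hj, hjd⟩, rfl⟩
    refine h i hi j hj ?_
    have := dist_triangle_right (f i) (f j) d
    linarith

theorem summable_norm_mul_norm {V : Type*} [NormedAddCommGroup V] {ξ η : ℕ → V}
    (hξ : Summable fun n => ‖ξ n‖ ^ 2) (hη : Summable fun n => ‖η n‖ ^ 2) :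
    Summable fun n => ‖ξ n‖ * ‖η n‖ :=
  Summable.of_nonneg_of_le (fun n => by positivity)
    (fun n => by nlinarith [sq_nonneg (‖ξ n‖ - ‖η n‖), sq_nonneg (‖ξ n‖), sq_nonneg (‖η n‖)])
    (hξ.add hη)

/-- The first `N` terms of `∑ ⟨ξ_n, ζ_n⟩` are estimated by the smallness of `ζ_n`, the others by the
smallness of the tail of `∑ ‖ξ_n‖ ‖η_n‖`. -/
theorem norm_le_of_hasSum_inner {V : Type*} [NormedAddCommGroup V] [InnerProductSpace ℂ V]
    {ξ η ζ : ℕ → V} {t : ℂ} (hsum : HasSum (fun n => inner ℂ (ξ n) (ζ n)) t)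
    (hξη : Summable fun n => ‖ξ n‖ * ‖η n‖) {N : ℕ} {R e b : ℝ}
    (hR : ∑ n ∈ Finset.range N, ‖ξ n‖ ≤ R) (he : 0 ≤ e) (hhead : ∀ n < N, ‖ζ n‖ ≤ e)
    (htail : ∀ n, ‖ζ n‖ ≤ 2 * ‖η n‖) (hb : ∑' n, ‖ξ (n + N)‖ * ‖η (n + N)‖ ≤ b) :
    ‖t‖ ≤ R * e + 2 * b := by
  have hle : ∀ n, ‖inner ℂ (ξ n) (ζ n)‖ ≤ 2 * (‖ξ n‖ * ‖η n‖) := fun n => by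
    refine (norm_inner_le_norm _ _).trans ?_
    nlinarith [htail n, norm_nonneg (ξ n)]
  have hs : Summable fun n => ‖inner ℂ (ξ n) (ζ n)‖ :=
    Summable.of_nonneg_of_le (fun n => norm_nonneg _) hle (hξη.mul_left 2)
  rw [← hsum.tsum_eq]
  refine (norm_tsum_le_tsum_norm hs).trans ?_
  rw [← hs.sum_add_tsum_nat_add N]
  refine add_le_add ?_ ?_
  · calc ∑ n ∈ Finset.range N, ‖inner ℂ (ξ n) (ζ n)‖ ≤ ∑ n ∈ Finset.range N, ‖ξ n‖ * e :=
        Finset.sum_le_sum fun n hn => (norm_inner_le_norm _ _).trans (by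
          gcongr; exact hhead n (Finset.mem_range.mp hn))
      _ = (∑ n ∈ Finset.range N, ‖ξ n‖) * e := by rw [Finset.sum_mul]
      _ ≤ R * e := by gcongr
  · have hs' := (summable_nat_add_iff N).mpr hξη
    calc ∑' n, ‖inner ℂ (ξ (n + N)) (ζ (n + N))‖
        ≤ ∑' n, 2 * (‖ξ (n + N)‖ * ‖η (n + N)‖) :=
          ((summable_nat_add_iff N).mpr hs).tsum_le_tsum (fun n => hle _) (hs'.mul_left 2)
      _ ≤ 2 * b := by rw [tsum_mul_left]; gcongr

section VonNeumann

variable {𝓗 : Type v} [NormedAddCommGroup 𝓗] [InnerProductSpace ℂ 𝓗] [CompleteSpace 𝓗]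

theorem IsNormalTrace.smul {M : VonNeumannAlgebra 𝓗} {τ : M.toStarSubalgebra →ₗ[ℂ] ℂ}
    (hτ : IsNormalTrace M τ) {c : ℂ} (hc : 0 ≤ c) : IsNormalTrace M (c • τ) where
  nonneg x := mul_nonneg hc (hτ.nonneg x)
  trace x y := congrArg (c * ·) (hτ.trace x y)
  normal := by
    obtain ⟨ξ, η, hξ, hη, h⟩ := hτ.normal
    refine ⟨ξ, fun n => c • η n, hξ, ?_, fun x => ?_⟩
    · simpa only [norm_smul, mul_pow] using hη.mul_left (‖c‖ ^ 2)
    · simp only [map_smul, inner_smul_right]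
      exact (h x).mul_left c

theorem IsFiniteVonNeumann.exists_trace_eq_one {M : VonNeumannAlgebra 𝓗}
    (hM : IsFiniteVonNeumann M) {p : M.toStarSubalgebra} (hp : star p * p = p) (hp0 : p ≠ 0) :
    ∃ τ : M.toStarSubalgebra →ₗ[ℂ] ℂ, IsNormalTrace M τ ∧ τ p = 1 := by
  obtain ⟨τ, hτ, h0⟩ := hM p hp0
  have hpos := hτ.nonneg p
  rw [hp] at h0 hpos
  refine ⟨(τ p)⁻¹ • τ, hτ.smul (inv_nonneg.mpr hpos), ?_⟩
  rw [LinearMap.smul_apply, smul_eq_mul, inv_mul_cancel₀ h0]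

theorem IsProjectiveRep.isCornerRep {G : Type u} [Group G] {M : VonNeumannAlgebra 𝓗}
    {p : 𝓗 →L[ℂ] 𝓗} {μ : scalarTwoCocycles G} {π : G → 𝓗 →L[ℂ] 𝓗} (hπ : IsProjectiveRep M p μ π)
    (hpM : p ∈ M) (hp : IsStarProjection p) :
    IsCornerRep (A := M.toStarSubalgebra) ⟨p, hpM⟩ μ.1 fun g => ⟨π g, (hπ.unitary g).mem⟩ where
  star_mul_self g := Subtype.ext (hπ.unitary g).star_mul_self
  mul_star_self g := Subtype.ext (hπ.unitary g).mul_star_self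
  left g := Subtype.ext (by
    change p * π g = π g
    rw [← (hπ.unitary g).corner, ← mul_assoc, ← mul_assoc, hp.isIdempotentElem.eq])
  mul g h := Subtype.ext (hπ.mul g h)

theorem IsCornerUnitary.norm_le_one {M : VonNeumannAlgebra 𝓗} {p u : 𝓗 →L[ℂ] 𝓗}
    (hu : IsCornerUnitary M p u) (hp : IsStarProjection p) : ‖u‖ ≤ 1 := by
  have h1 := CStarRing.norm_star_mul_self (x := u)
  rw [hu.star_mul_self] at h1
  have h2 := IsStarProjection.norm_le p hp
  nlinarith [norm_nonneg u]

end VonNeumann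

theorem HasRelativePropertyT.positiveDefinite {G : Type u} [Group G] {H : Subgroup G}
    (hT : HasRelativePropertyT H)
    (hU : Countable G ∨ H.Normal ∨ HasUniformRelativePropertyT H) :
    HasPositiveDefinitePropertyT H := by
  rcases hU with h | h | h
  · exact hT.positiveDefinite_of_countable
  · exact hT.positiveDefinite_of_normal h
  · exact h.positiveDefinite

theorem theorem1p2 {𝓗 : Type v} [NormedAddCommGroup 𝓗] [InnerProductSpace ℂ 𝓗] [CompleteSpace 𝓗]
    [TopologicalSpace.SeparableSpace 𝓗]
    (M : VonNeumannAlgebra 𝓗) (hM : IsFiniteVonNeumann M)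
    {G : Type u} [Group G] (H : Subgroup G) (hT : HasRelativePropertyT H)
    (hU : Countable G ∨ H.Normal ∨ HasUniformRelativePropertyT H)
    {J : Type w} (p : J → 𝓗 →L[ℂ] 𝓗)
    (hp : ∀ j, p j ∈ M ∧ IsStarProjection (p j) ∧ p j ≠ 0)
    (μ : J → scalarTwoCocycles G) (π : J → G → 𝓗 →L[ℂ] 𝓗)
    (hπ : ∀ j, IsProjectiveRep M (p j) (μ j) (π j)) :
    (Set.range fun j => (QuotientGroup.mk (restrictTwoCocycle H (μ j)) : ScalarH2 H)).Countable := by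
  classical
  have := UniformSpace.secondCountable_of_separable 𝓗
  obtain ⟨F, δ, hδ, hF⟩ := hT.positiveDefinite hU 0.01 (by norm_num)
  obtain ⟨δ', hδ'0, hδ'4, hδ'δ⟩ : ∃ δ' : ℝ, 0 < δ' ∧ δ' ≤ 1 / 4 ∧ 10 * δ' ≤ δ :=
    ⟨min (1 / 4) (δ / 10), by positivity, min_le_left _ _, by
      linarith [min_le_right (1 / 4) (δ / 10)]⟩
  have hrep := fun j => (hπ j).isCornerRep (hp j).1 (hp j).2.1
  have htrace := fun j => hM.exists_trace_eq_one
    (p := ⟨p j, (hp j).1⟩) (Subtype.ext (by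
      change star (p j) * p j = p j
      rw [(hp j).2.1.isSelfAdjoint.star_eq, (hp j).2.1.isIdempotentElem.eq]))
    fun h => (hp j).2.2 (congrArg Subtype.val h)
  choose τ hτ hτ1 using htrace
  choose ξ η hξ hη hsum using fun j => (hτ j).normal
  have hξη := fun j => summable_norm_mul_norm (hξ j) (hη j)
  have htail : ∀ j, ∃ N : ℕ, ∑' n, ‖ξ j (n + N)‖ * ‖η j (n + N)‖ ≤ δ' / 8 := fun j =>
    ((tendsto_sum_nat_add fun n => ‖ξ j n‖ * ‖η j n‖).eventually_le_const
      (show 0 < δ' / 8 by positivity)).exists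
  -- `N j` terms of the series for `τ j` suffice, and their `ξ`-parts have total norm at most `R j`
  choose N hN using htail
  choose R hR using fun j => exists_nat_ge (∑ n ∈ Finset.range (N j), ‖ξ j n‖)
  set κ : J → ScalarH2 H := fun j => QuotientGroup.mk (restrictTwoCocycle H (μ j)) with hκ
  have hcover : Set.range κ = ⋃ a : ℕ × ℕ, κ '' {j | (N j, R j) = a} := by
    ext c
    simp only [Set.mem_range, Set.mem_iUnion, Set.mem_image, Set.mem_ofPred_eq]
    constructor
    · rintro ⟨j, rfl⟩; exact ⟨_, j, rfl, rfl⟩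
    · rintro ⟨_, j, -, rfl⟩; exact ⟨j, rfl⟩
  rw [hcover]
  refine Set.countable_iUnion fun ⟨n₀, r₀⟩ => ?_
  have hnorm : ∀ j g, ‖π j g‖ ≤ 1 := fun j g => ((hπ j).unitary g).norm_le_one (hp j).2.1
  have hnorm' : ∀ j g, ‖star (π j g)‖ ≤ 1 := fun j g => by rw [norm_star]; exact hnorm j g
  have happly : ∀ (T : 𝓗 →L[ℂ] 𝓗), ‖T‖ ≤ 1 → ∀ x, ‖T x‖ ≤ ‖x‖ := fun T hT x =>
    (T.le_of_opNorm_le hT x).trans_eq (one_mul _)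
  -- the data that describe `j` up to a small error, among the `j` with given `N j` and `R j`
  let f : J → (Fin n₀ → 𝓗) × ((insert 1 F : Finset G) → Fin n₀ → 𝓗) := fun j =>
    (fun n => η j n, fun g n => star (π j g) (η j n))
  refine countable_image_of_dist_lt f κ _ (ε := δ' / (8 * (r₀ + 1))) (by positivity)
    fun i hi j hj hij => ?_
  obtain ⟨hNi, hRi⟩ := Prod.mk.inj hi
  set e := δ' / (8 * ((r₀ : ℝ) + 1)) with he
  have he0 : 0 < e := by positivity
  have hre : r₀ * (2 * e) ≤ δ' / 4 := by
    rw [he]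
    have : (r₀ : ℝ) * (2 * (δ' / (8 * (r₀ + 1)))) = δ' / 4 * (r₀ / (r₀ + 1)) := by field_simp; ring
    rw [this]
    have h2 : (r₀ : ℝ) / (r₀ + 1) ≤ 1 := div_le_one_of_le₀ (by linarith) (by positivity)
    nlinarith
  have hij1 : ∀ n < n₀, ‖η i n - η j n‖ ≤ e := fun n hn => by
    rw [← dist_eq_norm]
    exact (dist_le_pi_dist (f i).1 (f j).1 ⟨n, hn⟩).trans ((le_max_left _ _).trans hij.le)
  have hij2 : ∀ g ∈ insert 1 F, ∀ n < n₀, ‖star (π i g) (η i n) - star (π j g) (η j n)‖ ≤ e :=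
    fun g hg n hn => by
    rw [← dist_eq_norm]
    refine (dist_le_pi_dist ((f i).2 ⟨g, hg⟩) ((f j).2 ⟨g, hg⟩) ⟨n, hn⟩).trans ?_
    exact (dist_le_pi_dist (f i).2 (f j).2 ⟨g, hg⟩).trans ((le_max_right _ _).trans hij.le)
  set u : G → M.toStarSubalgebra := fun g => ⟨π i g, ((hπ i).unitary g).mem⟩
  set w : G → M.toStarSubalgebra := fun g => ⟨π j g, ((hπ j).unitary g).mem⟩
  have hclose : ∀ g ∈ insert 1 F, ‖τ i (u g * star (w g)) - 1‖ < δ' := fun g hg => by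
    have h1 : τ i (u g * star (w g)) - 1 = τ i (u g * (star (w g) - star (u g))) := by
      rw [mul_sub, map_sub, (hrep i).mul_star_self, hτ1]
    rw [h1]
    have h2 : ‖τ i (u g * (star (w g) - star (u g)))‖ ≤ r₀ * (2 * e) + 2 * (δ' / 8) := by
      refine norm_le_of_hasSum_inner (hsum i _) (hξη i) (N := n₀) ?_ (by positivity)
        (fun n hn => ?_) (fun n => ?_) ?_
      · rw [← hNi, ← hRi]; exact hR i
      · change ‖π i g (star (π j g) (η i n) - star (π i g) (η i n))‖ ≤ 2 * e
        refine (happly _ (hnorm i g) _).trans ?_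
        have h3 : star (π j g) (η i n) - star (π i g) (η i n) =
            star (π j g) (η i n - η j n) - (star (π i g) (η i n) - star (π j g) (η j n)) := by
          rw [map_sub]; abel
        rw [h3]
        refine (norm_sub_le _ _).trans ?_
        linarith [(happly _ (hnorm' j g) (η i n - η j n)).trans (hij1 n hn), hij2 g hg n hn]
      · change ‖π i g (star (π j g) (η i n) - star (π i g) (η i n))‖ ≤ 2 * ‖η i n‖
        refine (happly _ (hnorm i g) _).trans ((norm_sub_le _ _).trans ?_)
        linarith [happly _ (hnorm' j g) (η i n), happly _ (hnorm' i g) (η i n)]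
      · rw [← hNi]; exact hN i
    linarith
  have hcob := (hrep i).mem_coboundaries (hrep j) (μ i).2 (μ j).2 (hτ i).nonneg (hτ i).trace hF
    hδ'4 hδ'δ (hclose 1 (Finset.mem_insert_self _ _))
    fun g hg => hclose g (Finset.mem_insert_of_mem hg)
  refine (QuotientGroup.eq.mpr ?_).symm
  rw [Subgroup.mem_subgroupOf]
  convert hcob using 1
  funext g h
  exact mul_comm _ _
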